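/- **Conventions.** Indices $A,B,C,D,\dots$ run over $\{1,2\}$, indices $i,j,k,l,m,n$ over $\{0,1,2,3\}$; repeated indices are summed. $\mathbf 1_n$ is the unit $n\times n$ matrix, $\tau$ is the flip of two tensor factors, $\bar M$ is the entrywise complex conjugate (or entrywise $*$) of a matrix. $4\times4$ matrices on $\mathbb C^2\otimes\mathbb C^2$ are written in the basis ordered as $11,12,21,22$. $\sigma_0=\mathbf 1_2$ and $\sigma_1,\sigma_2,\sigma_3$ are the Pauli matrices, $V^{AB}{}_i=(\sigma_i)_{AB}$, $(V^{-1})^i{}_{AB}=\tfrac12\overline{(\sigma_i)_{AB}}$. **Quantum Lorentz data.** Let $E=(E^{AB})$, $E'=(E'_{AB})$ and $X=\tau Q'$ be given by one of the following seven cases, where $E$, $E'$ are written as $2\times2$ matrices (and also regarded as a column, respectively a row, of length 4), and $c\in\mathbb R\setminus\{0\}$: 1) $E=\begin{pmatrix}0&1\\-1&0\end{pmatrix}$, $E'=\begin{pmatrix}0&-1\\1&0\end{pmatrix}$, $Q'=\mathrm{diag}(t^{-1},t,t,t^{-1})$, $0<t\le1$; 2) $E,E'$ as in 1), $Q'=\mathbf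 1_4+c^2e_{14}$; 3) $E=\begin{pmatrix}c&1\\-1&0\end{pmatrix}$, $E'=\begin{pmatrix}0&-1\\1&c\end{pmatrix}$, $Q'=\mathbf 1_4+rc^2e_{14}$, $r\ge0$; 4) $E,E'$ as in 3), $Q'=\mathbf 1_4+c\,(e_{12}+e_{13}-e_{24}-e_{34})$; 5) $E=E'=\begin{pmatrix}0&1\\1&0\end{pmatrix}$, $Q'=i\,\mathrm{diag}(t^{-1},-t,-t,t^{-1})$, $0<t\le1$; 6) $E,E'$ as in 5), $Q'=i\,(\mathrm{diag}(1,-1,-1,1)+c^2e_{14})$; 7) $E,E'$ as in 5), $Q'=i\begin{pmatrix}r&0&0&\varsigma\\0&-r&\varsigma&0\\0&\varsigma&-r&0\\\varsigma&0&0&r\end{pmatrix}$, $r=\tfrac12(t+t^{-1})$, $\varsigma=\tfrac12(t-t^{-1})$, $0<t<1$. Here $e_{ab}$ are the $4\times4$ matrix units. Put $q=1$, $q^{1/2}=1$ in cases 1)–4) and $q=-1$, $q^{1/2}=i$ in cases 5)–7). Let $s\in\{1,-1\}$ and let $H^{ABC}{}_D,\ T^{ABCD}\in\mathbb C$ be arbitrary.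 Set $$L=s\,q^{1/2}(\mathbf 1_4+qEE'),\qquad \tilde L=q\tau L\tau,\qquad G=(V^{-1}\otimes\mathbf 1_2)(\mathbf 1_2\otimes X)(L\otimes\mathbf 1_2)(\mathbf 1_2\otimes V),$$ $$R=(V^{-1}\otimes V^{-1})(\mathbf 1_2\otimes X\otimes\mathbf 1_2)(L\otimes\tilde L)(\mathbf 1_2\otimes X^{-1}\otimes\mathbf 1_2)(V\otimes V),$$ $$(H_V)^{iC}{}_D=(V^{-1})^i{}_{AB}H^{ABC}{}_D,\qquad \tilde H_V=-\tau\overline{G^{-1}H_V},\qquad T^{ij}=(V^{-1})^i{}_{AB}(V^{-1})^j{}_{CD}T^{ABCD},$$ $$Z=(\mathbf 1_4\otimes V^{-1})\bigl[H_V\otimes\mathbf 1_2+(G\otimes\mathbf 1_2)(\mathbf 1_2\otimes\tilde H_V)\bigr]V .$$ **Algebras and action.** Let $\mathcal B$ be the universal unital complex $*$-algebra generated by $w^A{}_B$ and $y^i$ subject to $$w^A{}_Bw^C{}_DE^{BD}=E^{AC},\qquad E'_{AC}w^A{}_Bw^C{}_D=E'_{BD},\qquad X^{AB}{}_{CD}\,w^C{}_K(w^D{}_L)^*=(w^A{}_C)^*w^B{}_D\,X^{CD}{}_{KL},$$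 $$(R-\mathbf 1)^{ij}{}_{kl}\bigl(y^ky^l-Z^{kl}{}_my^m+T^{kl}-\Lambda^k{}_m\Lambda^l{}_nT^{mn}\bigr)=0,$$ $$y^iw^A{}_B=G^{iA}{}_{Cj}w^C{}_By^j+(H_V)^{iA}{}_Cw^C{}_B-\Lambda^i{}_jw^A{}_C(H_V)^{jC}{}_B,\qquad (y^i)^*=y^i,$$ where $\Lambda=V^{-1}(w\otimes\bar w)V$ and $\bar w=((w^A{}_B)^*)$. Let $\mathcal C$ be the universal unital complex $*$-algebra generated by $x^i$ subject to $$(R-\mathbf 1)^{ij}{}_{kl}\bigl(x^kx^l-Z^{kl}{}_mx^m+T^{kl}\bigr)=0,\qquad (x^i)^*=x^i .$$ ($\mathcal B$ and $\mathcal C$ are the polynomials on a quantum Poincaré group and on its quantum Minkowski space.) Let $\Psi:\mathcal C\to\mathcal B\otimes\mathcal C$ be the unital $*$-homomorphism with $\Psi(x^i)=\Lambda^i{}_j\otimes x^j+y^i\otimes I$ (it exists for all the above data). Partial derivatives are linear maps $\partial_i:\mathcal C\to\mathcal C$ with $$\partial_i(I)=0,\qquad \partial_i(x^kf)=\delta^k{}_if+(R^{kl}{}_{in}x^n+Z^{kl}{}_i)\,\partial_lf\qquad(f\in\mathcal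 C).$$ They do not exist for all $H,T$ (for $H=T=0$ they do); they are unique if they exist. **Bispinors.** Let $\tilde{\mathcal C}=\mathbb C^4\otimes\mathcal C$, let $\varepsilon_a$ $(a=1,\dots,4)$ be the standard basis of $\mathbb C^4=\mathbb C^2\oplus\mathbb C^2$ and $\lambda_a$ the dual basis. With ${}^cw=(w^T)^{-1}=E^{-1}wE$ put $\mathcal G={}^cw\oplus\bar w$, and define $\tilde\Psi:\tilde{\mathcal C}\to\mathcal B\otimes\tilde{\mathcal C}$ by $$\tilde\Psi(\varepsilon_a\otimes\phi^a)=\mathcal G_a{}^l\,\phi^{a(1)}\otimes\varepsilon_l\otimes\phi^{a(2)},\qquad \Psi(\phi^a)=\phi^{a(1)}\otimes\phi^{a(2)} .$$ Put $D=\tau X^{-1}\tau$, $(\sigma_i\circ D)_{KL}=(\sigma_i)_{AB}D^{AB}{}_{KL}$, $$A_i=q^{-1/2}E^T(\sigma_i\circ D)E,\qquad \gamma^i=\begin{pmatrix}0&A_i\\\sigma_i&0\end{pmatrix},\qquad \partial\!\!\!/=\gamma^i\otimes\partial_i,$$ $$K=-E(E^{-1})^T,\qquad A=\begin{pmatrix}0&K^T\\K&0\end{pmatrix}.$$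 For $\phi=\varepsilon_a\otimes\phi^a\in\tilde{\mathcal C}$ let $\phi^\dagger=\lambda_a\otimes(\phi^a)^*$ and $\bar\phi=\phi^\dagger(A\otimes I)$, and let $(b_a\otimes c_a)^\dagger=b_a^*\otimes c_a^\dagger$ for $b_a\in\mathcal B$, $c_a\in\tilde{\mathcal C}$. **Proposition 2.3.** For all $\phi,\chi\in\tilde{\mathcal C}$, $$(\tilde\Psi\phi)^\dagger(I\otimes A\otimes I)(\tilde\Psi\chi)=\Psi\bigl[\phi^\dagger(A\otimes I)\chi\bigr]=\Psi(\bar\phi\chi).$$ If moreover $\mathcal C$ admits partial derivatives $\partial_i$ as above, then for every $m\in\mathbb C$ and all $\phi,\chi\in\tilde{\mathcal C}$, $$(\tilde\Psi\phi)^\dagger(I\otimes A\otimes I)\,[I\otimes(i\partial\!\!\!/ -m)]\,(\tilde\Psi\chi)=\Psi\bigl[\phi^\dagger(A\otimes I)(i\partial\!\!\!/ -m)\chi\bigr]=\Psi\bigl[\bar\phi\,(i\partial\!\!\!/ -m)\chi\bigr].$$ -/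

import Mathlib

open scoped TensorProduct Kronecker

noncomputable section

namespace QMink

/-- The free unital complex `*`-algebra on a family `X` of generators: words in the symbols
`x = (x, false)` and `x* = (x, true)`. -/
def FreeStar (X : Type) : Type := FreeAlgebra ℂ (X × Bool)

namespace FreeStar

variable {X : Type}

instance : Ring (FreeStar X) := inferInstanceAs (Ring (FreeAlgebra ℂ (X × Bool)))
instance : Algebra ℂ (FreeStar X) := inferInstanceAs (Algebra ℂ (FreeAlgebra ℂ (X × Bool)))

/-- The symbols `x` and `x*` as elements. -/
def gen (p : X × Bool) : FreeStar X := FreeAlgebra.ι ℂ p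

/-- The generator `x`. -/
def of (x : X) : FreeStar X := gen (x, false)

/-- An algebra with the scalar multiplication twisted by complex conjugation. -/
abbrev conjAlgebra (S : Type*) [Ring S] [Algebra ℂ S] : Algebra ℂ S :=
  Algebra.compHom S (starRingEnd ℂ)

/-- The additive, antimultiplicative, conjugate linear map exchanging `x` and `x*`. -/
def starHom (X : Type) : FreeStar X →+* (FreeStar X)ᵐᵒᵖ :=
  letI : Algebra ℂ (FreeStar X)ᵐᵒᵖ := conjAlgebra (FreeStar X)ᵐᵒᵖ
  (FreeAlgebra.lift ℂ fun p : X × Bool =>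
    MulOpposite.op (gen (p.1, !p.2))).toRingHom

theorem starHom_ι (p : X × Bool) :
    starHom X (gen p) =
      MulOpposite.op (gen (p.1, !p.2)) := by
  let _ : Algebra ℂ (FreeStar X)ᵐᵒᵖ := conjAlgebra (FreeStar X)ᵐᵒᵖ
  exact FreeAlgebra.lift_ι_apply (R := ℂ) (A := (FreeStar X)ᵐᵒᵖ)
    (fun p : X × Bool => MulOpposite.op (gen (p.1, !p.2))) p

theorem starHom_algebraMap (z : ℂ) :
    starHom X (algebraMap ℂ (FreeStar X) z) =
      MulOpposite.op (algebraMap ℂ (FreeStar X) (star z)) := by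
  let _ : Algebra ℂ (FreeStar X)ᵐᵒᵖ := conjAlgebra (FreeStar X)ᵐᵒᵖ
  exact (FreeAlgebra.lift ℂ fun p : X × Bool =>
    MulOpposite.op (gen (p.1, !p.2))).commutes z

@[elab_as_elim]
theorem induction {motive : FreeStar X → Prop}
    (scalar : ∀ z : ℂ, motive (algebraMap ℂ (FreeStar X) z))
    (gen : ∀ p : X × Bool, motive (gen p))
    (mul : ∀ a b, motive a → motive b → motive (a * b))
    (add : ∀ a b, motive a → motive b → motive (a + b)) (a : FreeStar X) : motive a :=
  FreeAlgebra.induction ℂ (X × Bool) (motive := motive) scalar gen mul add a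

instance : StarRing (FreeStar X) where
  star a := (starHom X a).unop
  star_involutive a := by
    induction a using FreeStar.induction with
    | scalar z => simp [starHom_algebraMap]
    | gen p => simp [starHom_ι]
    | mul a b ha hb => simp [ha, hb]
    | add a b ha hb => simp [ha, hb]
  star_mul a b := by simp
  star_add a b := by simp

theorem star_def (a : FreeStar X) : star a = (starHom X a).unop := rfl

instance : StarModule ℂ (FreeStar X) where
  star_smul z a := by
    simp [Algebra.smul_def, star_def, starHom_algebraMap, Algebra.commutes]

theorem star_of (x : X) : star (of x) = gen (x, true) := by
  rw [star_def, of, starHom_ι]; rfl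

section lift

variable {S : Type*} [Ring S] [StarRing S] [Algebra ℂ S] [StarModule ℂ S]

/-- Universal property of the free `*`-algebra. -/
def lift (f : X → S) : FreeStar X →⋆ₐ[ℂ] S :=
  { (FreeAlgebra.lift ℂ fun p : X × Bool => if p.2 then star (f p.1) else f p.1 :
      FreeAlgebra ℂ (X × Bool) →ₐ[ℂ] S) with
    map_star' := fun a => by
      change (FreeAlgebra.lift ℂ fun p : X × Bool => if p.2 then star (f p.1) else f p.1)
        (star a : FreeStar X) = star ((FreeAlgebra.lift ℂ fun p : X × Bool =>
          if p.2 then star (f p.1) else f p.1) a)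
      set F : FreeStar X →ₐ[ℂ] S :=
        (FreeAlgebra.lift ℂ fun p : X × Bool => if p.2 then star (f p.1) else f p.1) with hF
      have hι : ∀ p : X × Bool, F (gen p) =
          if p.2 then star (f p.1) else f p.1 := fun p => by
        rw [hF]; exact FreeAlgebra.lift_ι_apply _ _
      change F (star a) = star (F a)
      induction a using FreeStar.induction with
      | scalar z =>
        rw [star_def, starHom_algebraMap, MulOpposite.unop_op, AlgHom.commutes, AlgHom.commutes,
          algebraMap_star_comm]
      | gen p =>
        rw [star_def, starHom_ι, MulOpposite.unop_op, hι, hι]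
        rcases p with ⟨x, b⟩
        cases b <;> simp
      | mul a b ha hb => rw [star_mul, map_mul, ha, hb, map_mul, star_mul]
      | add a b ha hb => rw [star_add, map_add, ha, hb, map_add, star_add] }

@[simp] theorem lift_of (f : X → S) (x : X) : lift f (of x) = f x :=
  (FreeAlgebra.lift_ι_apply _ _).trans (by simp)

end lift

end FreeStar

/-- The smallest relation containing `r` and closed under the star. -/
inductive StarClosure {X : Type} (r : FreeStar X → FreeStar X → Prop) :
    FreeStar X → FreeStar X → Prop
  | base {a b} (h : r a b) : StarClosure r a b
  | star {a b} (h : StarClosure r a b) : StarClosure r (Star.star a) (Star.star b)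

/-- The universal unital complex `*`-algebra generated by `X` subject to the relations `r`. -/
def UnivStar (X : Type) (r : FreeStar X → FreeStar X → Prop) : Type :=
  RingQuot (StarClosure r)

namespace UnivStar

variable {X : Type} {r : FreeStar X → FreeStar X → Prop}

instance : Ring (UnivStar X r) := inferInstanceAs (Ring (RingQuot (StarClosure r)))
instance : Algebra ℂ (UnivStar X r) := inferInstanceAs (Algebra ℂ (RingQuot (StarClosure r)))
instance : StarRing (UnivStar X r) :=
  RingQuot.starRing (StarClosure r) fun _ _ h => StarClosure.star h

/-- The quotient map from the free `*`-algebra, as an algebra homomorphism. -/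
def mkAlg (X : Type) (r : FreeStar X → FreeStar X → Prop) : FreeStar X →ₐ[ℂ] UnivStar X r :=
  RingQuot.mkAlgHom ℂ (StarClosure r)

theorem mkAlg_surjective : Function.Surjective (mkAlg X r) :=
  RingQuot.mkAlgHom_surjective ℂ (StarClosure r)

theorem mkAlg_star (a : FreeStar X) : mkAlg X r (star a) = star (mkAlg X r a) := by
  simp only [mkAlg, RingQuot.mkAlgHom_def, RingQuot.mkRingHom_def]
  rfl

instance : StarModule ℂ (UnivStar X r) where
  star_smul z a := by
    obtain ⟨a, rfl⟩ := mkAlg_surjective a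
    rw [← map_smul, ← mkAlg_star, star_smul, map_smul, mkAlg_star]

/-- The quotient map from the free `*`-algebra. -/
def mk (X : Type) (r : FreeStar X → FreeStar X → Prop) : FreeStar X →⋆ₐ[ℂ] UnivStar X r :=
  { mkAlg X r with map_star' := mkAlg_star }

/-- The image of a generator. -/
def of (x : X) : UnivStar X r := mk X r (FreeStar.of x)

theorem mk_of (x : X) : mk X r (FreeStar.of x) = of x := rfl

theorem mk_eq {a b : FreeStar X} (h : r a b) : mk X r a = mk X r b :=
  RingQuot.mkAlgHom_rel ℂ (StarClosure.base h)

section lift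

variable {S : Type*} [Ring S] [StarRing S] [Algebra ℂ S] [StarModule ℂ S]

/-- Universal property of the universal `*`-algebra. -/
def lift (f : X → S) (hf : ∀ a b, r a b → FreeStar.lift f a = FreeStar.lift f b) :
    UnivStar X r →⋆ₐ[ℂ] S :=
  have hf' : ∀ ⦃a b⦄, StarClosure r a b →
      (FreeStar.lift f).toAlgHom a = (FreeStar.lift f).toAlgHom b := by
    intro a b h
    induction h with
    | base h => exact hf _ _ h
    | star h ih =>
      exact (map_star (FreeStar.lift f) _).trans
        ((congrArg star ih).trans (map_star (FreeStar.lift f) _).symm)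
  { (RingQuot.liftAlgHom ℂ (s := StarClosure r) ⟨(FreeStar.lift f).toAlgHom, hf'⟩ :
      RingQuot (StarClosure r) →ₐ[ℂ] S) with
    map_star' := fun a => by
      have key : ∀ c : FreeStar X,
          (RingQuot.liftAlgHom ℂ (s := StarClosure r) ⟨(FreeStar.lift f).toAlgHom, hf'⟩)
            (mkAlg X r c) = FreeStar.lift f c := fun c =>
        RingQuot.liftAlgHom_mkAlgHom_apply ℂ _ _ c
      obtain ⟨c, rfl⟩ := mkAlg_surjective (r := r) a
      rw [← mkAlg_star]
      exact (key _).trans ((map_star (FreeStar.lift f) c).trans (congrArg star (key c).symm)) }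

@[simp] theorem lift_of (f : X → S) (hf : ∀ a b, r a b → FreeStar.lift f a = FreeStar.lift f b)
    (x : X) : lift f hf (of x : UnivStar X r) = f x :=
  (RingQuot.liftAlgHom_mkAlgHom_apply ℂ _ _ _).trans (FreeStar.lift_of f x)

end lift

end UnivStar

/-! The matrices describing the quantum Lorentz and Poincare groups -/

/-- The seven families of quantum Lorentz groups which admit quantum Poincare groups. -/
inductive LorentzType : Type
  | type1 (t : ℝ) (ht : 0 < t) (ht' : t ≤ 1)
  | type2 (c : ℝ) (hc : c ≠ 0)
  | type3 (c : ℝ) (hc : c ≠ 0) (r : ℝ) (hr : 0 ≤ r)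
  | type4 (c : ℝ) (hc : c ≠ 0)
  | type5 (t : ℝ) (ht : 0 < t) (ht' : t ≤ 1)
  | type6 (c : ℝ) (hc : c ≠ 0)
  | type7 (t : ℝ) (ht : 0 < t) (ht' : t < 1)

/-- A pair of indices with values in `{1, 2}`; pairs are ordered as `11, 12, 21, 22`. -/
abbrev I2 : Type := Fin 2 × Fin 2

namespace LorentzType

/-- The coefficients `E^{AB}` of `E`, as a `2 × 2` matrix. -/
def E : LorentzType → Matrix (Fin 2) (Fin 2) ℂ
  | type1 _ _ _ => !![0, 1; -1, 0]
  | type2 _ _ => !![0, 1; -1, 0]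
  | type3 c _ _ _ => !![(c : ℂ), 1; -1, 0]
  | type4 c _ => !![(c : ℂ), 1; -1, 0]
  | type5 _ _ _ => !![0, 1; 1, 0]
  | type6 _ _ => !![0, 1; 1, 0]
  | type7 _ _ _ => !![0, 1; 1, 0]

/-- The coefficients `E'_{AB}` of `E'`, as a `2 × 2` matrix. -/
def E' : LorentzType → Matrix (Fin 2) (Fin 2) ℂ
  | type1 _ _ _ => !![0, -1; 1, 0]
  | type2 _ _ => !![0, -1; 1, 0]
  | type3 c _ _ _ => !![0, -1; 1, (c : ℂ)]
  | type4 c _ => !![0, -1; 1, (c : ℂ)]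
  | type5 _ _ _ => !![0, 1; 1, 0]
  | type6 _ _ => !![0, 1; 1, 0]
  | type7 _ _ _ => !![0, 1; 1, 0]

/-- The `4 × 4` matrix `Q'`, with rows and columns numbered by `0, 1, 2, 3`. -/
def Q4 : LorentzType → Matrix (Fin 4) (Fin 4) ℂ
  | type1 t _ _ => !![(t : ℂ)⁻¹, 0, 0, 0; 0, (t : ℂ), 0, 0; 0, 0, (t : ℂ), 0; 0, 0, 0, (t : ℂ)⁻¹]
  | type2 c _ => !![1, 0, 0, (c : ℂ) ^ 2; 0, 1, 0, 0; 0, 0, 1, 0; 0, 0, 0, 1]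
  | type3 c _ r _ => !![1, 0, 0, (r : ℂ) * (c : ℂ) ^ 2; 0, 1, 0, 0; 0, 0, 1, 0; 0, 0, 0, 1]
  | type4 c _ => !![1, (c : ℂ), (c : ℂ), 0; 0, 1, 0, -(c : ℂ); 0, 0, 1, -(c : ℂ); 0, 0, 0, 1]
  | type5 t _ _ => Complex.I •
      !![(t : ℂ)⁻¹, 0, 0, 0; 0, -(t : ℂ), 0, 0; 0, 0, -(t : ℂ), 0; 0, 0, 0, (t : ℂ)⁻¹]
  | type6 c _ => Complex.I • !![1, 0, 0, (c : ℂ) ^ 2; 0, -1, 0, 0; 0, 0, -1, 0; 0, 0, 0, 1]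
  | type7 t _ _ =>
      let r : ℂ := ((t : ℂ) + (t : ℂ)⁻¹) / 2
      let z : ℂ := ((t : ℂ) - (t : ℂ)⁻¹) / 2
      Complex.I • !![r, 0, 0, z; 0, -r, z, 0; 0, z, -r, 0; z, 0, 0, r]

/-- The matrix `Q'` with rows and columns indexed by pairs of indices. -/
def Q (D : LorentzType) : Matrix I2 I2 ℂ :=
  D.Q4.submatrix (finProdFinEquiv : I2 ≃ Fin (2 * 2)) (finProdFinEquiv : I2 ≃ Fin (2 * 2))

/-- `X = τ Q'`, where `τ` is the flip: `X^{AB}_{CD} = Q'^{BA}_{CD}`. -/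
def X (D : LorentzType) : Matrix I2 I2 ℂ := D.Q.submatrix Prod.swap id

/-- The sign `q`, which is `1` for types 1 to 4 and `-1` for types 5 to 7. -/
def q : LorentzType → ℂ
  | type1 _ _ _ => 1
  | type2 _ _ => 1
  | type3 _ _ _ _ => 1
  | type4 _ _ => 1
  | type5 _ _ _ => -1
  | type6 _ _ => -1
  | type7 _ _ _ => -1

/-- The chosen square root `q^{1/2}`: it is `1` for `q = 1` and `i` for `q = -1`. -/
def qh : LorentzType → ℂ
  | type1 _ _ _ => 1
  | type2 _ _ => 1
  | type3 _ _ _ _ => 1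
  | type4 _ _ => 1
  | type5 _ _ _ => Complex.I
  | type6 _ _ => Complex.I
  | type7 _ _ _ => Complex.I

end LorentzType

/-- The Pauli matrices `σ_0, σ_1, σ_2, σ_3`. -/
def pauli : Fin 4 → Matrix (Fin 2) (Fin 2) ℂ
  | 0 => !![1, 0; 0, 1]
  | 1 => !![0, 1; 1, 0]
  | 2 => !![0, -Complex.I; Complex.I, 0]
  | 3 => !![1, 0; 0, -1]

/-- `V^{AB}_i = (σ_i)_{AB}`. -/
def V : Matrix I2 (Fin 4) ℂ := Matrix.of fun p i => pauli i p.1 p.2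

/-- `(V⁻¹)^i_{AB} = (1/2) conj (σ_i)_{AB}`; see `Vi_mul_V` and `V_mul_Vi`. -/
def Vi : Matrix (Fin 4) I2 ℂ := Matrix.of fun i p => (1 / 2) * star (pauli i p.1 p.2)

theorem Vi_mul_V : Vi * V = 1 := by
  ext i j
  rw [Matrix.mul_apply, Fintype.sum_prod_type]
  fin_cases i <;> fin_cases j <;> simp [V, Vi, pauli, Fin.sum_univ_two, mul_assoc] <;> norm_num

theorem V_mul_Vi : V * Vi = 1 := by
  ext ⟨a, b⟩ ⟨c, d⟩
  rw [Matrix.mul_apply]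
  fin_cases a <;> fin_cases b <;> fin_cases c <;> fin_cases d <;>
    simp [V, Vi, pauli, Fin.sum_univ_four, mul_left_comm Complex.I] <;> norm_num

/-- The data of a quantum Poincare group: a quantum Lorentz group, a sign `s`, and the
coefficients `H^{ABC}_D`, `T^{ABCD}` of the commutation relations of the translations. -/
structure PoincareData : Type where
  lorentz : LorentzType
  s : ℂ
  s_eq : s = 1 ∨ s = -1
  H : Fin 2 → Fin 2 → Fin 2 → Fin 2 → ℂ
  T : Fin 2 → Fin 2 → Fin 2 → Fin 2 → ℂ

section assoc

variable {a b c d : Type}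

/-- Identify row indices `a × (b × c)` with `(a × b) × c`. -/
def rowAssoc (M : Matrix (a × (b × c)) d ℂ) : Matrix ((a × b) × c) d ℂ :=
  M.submatrix (Equiv.prodAssoc a b c) id

/-- Identify column indices `a × (b × c)` with `(a × b) × c`. -/
def colAssoc (M : Matrix d (a × (b × c)) ℂ) : Matrix d ((a × b) × c) ℂ :=
  M.submatrix id (Equiv.prodAssoc a b c)

end assoc

/-- `1 ⊗ M ⊗ 1`, acting on the two middle ones of four indices. -/
def mid (M : Matrix I2 I2 ℂ) : Matrix (I2 × I2) (I2 × I2) ℂ :=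
  Matrix.of fun p k =>
    if p.1.1 = k.1.1 ∧ p.2.2 = k.2.2 then M (p.1.2, p.2.1) (k.1.2, k.2.1) else 0

namespace PoincareData

variable (P : PoincareData)

/-- `L = s q^{1/2} (1 + q E E')`. -/
def L : Matrix I2 I2 ℂ :=
  (P.s * P.lorentz.qh) •
    (1 + P.lorentz.q • Matrix.of fun p k => P.lorentz.E p.1 p.2 * P.lorentz.E' k.1 k.2)

/-- `L~ = q τ L τ`. -/
def Lt : Matrix I2 I2 ℂ := P.lorentz.q • P.L.submatrix Prod.swap Prod.swap

/-- `G = (V⁻¹ ⊗ 1)(1 ⊗ X)(L ⊗ 1)(1 ⊗ V)`. -/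
def G : Matrix (Fin 4 × Fin 2) (Fin 2 × Fin 4) ℂ :=
  (Vi ⊗ₖ (1 : Matrix (Fin 2) (Fin 2) ℂ)) *
    rowAssoc (colAssoc ((1 : Matrix (Fin 2) (Fin 2) ℂ) ⊗ₖ P.lorentz.X)) *
    (P.L ⊗ₖ (1 : Matrix (Fin 2) (Fin 2) ℂ)) * rowAssoc ((1 : Matrix (Fin 2) (Fin 2) ℂ) ⊗ₖ V)

/-- `G⁻¹ = (1 ⊗ V⁻¹)(L⁻¹ ⊗ 1)(1 ⊗ X⁻¹)(V ⊗ 1)`; see `G_mul_Gi` and `Gi_mul_G`. -/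
def Gi : Matrix (Fin 2 × Fin 4) (Fin 4 × Fin 2) ℂ :=
  colAssoc ((1 : Matrix (Fin 2) (Fin 2) ℂ) ⊗ₖ Vi) *
    (P.L⁻¹ ⊗ₖ (1 : Matrix (Fin 2) (Fin 2) ℂ)) *
    rowAssoc (colAssoc ((1 : Matrix (Fin 2) (Fin 2) ℂ) ⊗ₖ P.lorentz.X⁻¹)) *
    (V ⊗ₖ (1 : Matrix (Fin 2) (Fin 2) ℂ))

/-- `R = (V⁻¹ ⊗ V⁻¹)(1 ⊗ X ⊗ 1)(L ⊗ L~)(1 ⊗ X⁻¹ ⊗ 1)(V ⊗ V)`. -/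
def R : Matrix (Fin 4 × Fin 4) (Fin 4 × Fin 4) ℂ :=
  (Vi ⊗ₖ Vi) * mid P.lorentz.X * (P.L ⊗ₖ P.Lt) * mid P.lorentz.X⁻¹ * (V ⊗ₖ V)

/-- `(H_V)^{iC}_D = (V⁻¹)^i_{AB} H^{ABC}_D`. -/
def HV : Matrix (Fin 4 × Fin 2) (Fin 2) ℂ :=
  Matrix.of fun p D => ∑ A, ∑ B, Vi p.1 (A, B) * P.H A B p.2 D

/-- `H~_V = -τ conj (G⁻¹ H_V)`. -/
def HVt : Matrix (Fin 4 × Fin 2) (Fin 2) ℂ :=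
  Matrix.of fun p D => -star ((P.Gi * P.HV) p.swap D)

/-- `Z = (1 ⊗ V⁻¹)[H_V ⊗ 1 + (G ⊗ 1)(1 ⊗ H~_V)] V`. -/
def Z : Matrix (Fin 4 × Fin 4) (Fin 4) ℂ :=
  colAssoc ((1 : Matrix (Fin 4) (Fin 4) ℂ) ⊗ₖ Vi) *
    (P.HV ⊗ₖ (1 : Matrix (Fin 2) (Fin 2) ℂ) +
      (P.G ⊗ₖ (1 : Matrix (Fin 2) (Fin 2) ℂ)) *
        rowAssoc ((1 : Matrix (Fin 2) (Fin 2) ℂ) ⊗ₖ P.HVt)) * V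

/-- `T^{ij} = (V⁻¹)^i_{AB} (V⁻¹)^j_{CD} T^{ABCD}`. -/
def TV (i j : Fin 4) : ℂ :=
  ∑ A, ∑ B, ∑ C, ∑ D, Vi i (A, B) * Vi j (C, D) * P.T A B C D

end PoincareData

/-! The algebras of polynomials on the quantum Poincare group and the quantum Minkowski space -/

section Lambda

variable {S : Type*} [Ring S] [Algebra ℂ S]

/-- A scalar matrix regarded as a matrix over a complex algebra. -/
def scalarMat (S : Type*) [Ring S] [Algebra ℂ S] {m n : Type*} (M : Matrix m n ℂ) :
    Matrix m n S := M.map (algebraMap ℂ S)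

/-- `Λ = V⁻¹ (w ⊗ w̄) V`, where `w̄^A_B = (w^A_B)*`. -/
def LambdaMat [Star S] (w : Matrix (Fin 2) (Fin 2) S) : Matrix (Fin 4) (Fin 4) S :=
  scalarMat S Vi * (w ⊗ₖ w.map star) * scalarMat S V

end Lambda

/-- The generators `w^A_B` and `y^i` of the algebra of polynomials on a quantum Poincare group. -/
inductive PGen : Type
  | w (A B : Fin 2)
  | y (i : Fin 4)

namespace PGen

/-- The matrix `w` over the free `*`-algebra. -/
def wF : Matrix (Fin 2) (Fin 2) (FreeStar PGen) := Matrix.of fun A B => FreeStar.of (PGen.w A B)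

/-- The element `y^i` of the free `*`-algebra. -/
def yF (i : Fin 4) : FreeStar PGen := FreeStar.of (PGen.y i)

end PGen

namespace PoincareData

variable (P : PoincareData)

open PGen in
/-- The defining relations of the `*`-algebra of polynomials on a quantum Poincare group; the first
three are the relations of the quantum Lorentz group. -/
inductive PRel : FreeStar PGen → FreeStar PGen → Prop
  | E_rel (A C : Fin 2) : PRel
      (∑ B, ∑ D, P.lorentz.E B D • (wF A B * wF C D)) (P.lorentz.E A C • 1)
  | E'_rel (B D : Fin 2) : PRel
      (∑ A, ∑ C, P.lorentz.E' A C • (wF A B * wF C D)) (P.lorentz.E' B D • 1)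
  | X_rel (A B K L : Fin 2) : PRel
      (∑ C, ∑ D, P.lorentz.X (A, B) (C, D) • (wF C K * star (wF D L)))
      (∑ C, ∑ D, P.lorentz.X (C, D) (K, L) • (star (wF A C) * wF B D))
  | y_rel (i j : Fin 4) : PRel
      (∑ k, ∑ l, (P.R - 1) (i, j) (k, l) •
        (yF k * yF l - ∑ m, P.Z (k, l) m • yF m + P.TV k l • 1
          - ∑ m, ∑ n, P.TV m n • (LambdaMat wF k m * LambdaMat wF l n))) 0
  | yw_rel (i : Fin 4) (A B : Fin 2) : PRel
      (yF i * wF A B)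
      (∑ C, ∑ j, P.G (i, A) (C, j) • (wF C B * yF j) + ∑ C, P.HV (i, A) C • wF C B
        - ∑ j, ∑ C, P.HV (j, C) B • (LambdaMat wF i j * wF A C))
  | y_star (i : Fin 4) : PRel (star (yF i)) (yF i)

/-- The `*`-algebra of polynomials on the quantum Poincare group. -/
abbrev Poincare : Type := UnivStar PGen P.PRel

/-- The coordinates `x^i` in the free `*`-algebra. -/
def xF (i : Fin 4) : FreeStar (Fin 4) := FreeStar.of i

/-- The defining relations of the `*`-algebra of polynomials on a quantum Minkowski space. -/
inductive MRel : FreeStar (Fin 4) → FreeStar (Fin 4) → Prop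
  | x_rel (i j : Fin 4) : MRel
      (∑ k, ∑ l, (P.R - 1) (i, j) (k, l) •
        (xF k * xF l - ∑ m, P.Z (k, l) m • xF m + P.TV k l • 1)) 0
  | x_star (i : Fin 4) : MRel (star (xF i)) (xF i)

/-- The `*`-algebra of polynomials on the quantum Minkowski space. -/
abbrev Minkowski : Type := UnivStar (Fin 4) P.MRel

/-- The matrix `w` over the algebra of the quantum Poincare group. -/
def w : Matrix (Fin 2) (Fin 2) P.Poincare := Matrix.of fun A B => UnivStar.of (PGen.w A B)

/-- The translation coordinates `y^i`. -/
def y (i : Fin 4) : P.Poincare := UnivStar.of (PGen.y i)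

/-- The conjugate representation `w̄`. -/
def wbar : Matrix (Fin 2) (Fin 2) P.Poincare := P.w.map star

/-- The representation `Λ`. -/
def Lam : Matrix (Fin 4) (Fin 4) P.Poincare := LambdaMat P.w

/-- The coordinates `x^i` of the quantum Minkowski space. -/
def x (i : Fin 4) : P.Minkowski := UnivStar.of i

end PoincareData

namespace LorentzType

variable (D : LorentzType)

theorem E_mul_E' : D.E * D.E' = 1 := by
  cases D <;> ext i j <;> fin_cases i <;> fin_cases j <;>
    simp [E, E', Matrix.mul_apply, Fin.sum_univ_two]

theorem E'_mul_E : D.E' * D.E = 1 := by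
  cases D <;> ext i j <;> fin_cases i <;> fin_cases j <;>
    simp [E, E', Matrix.mul_apply, Fin.sum_univ_two]

theorem E_inv : D.E⁻¹ = D.E' := Matrix.inv_eq_right_inv D.E_mul_E'

theorem sum_E'_E : ∑ A, ∑ B, D.E' A B * D.E A B = -2 * D.q := by
  cases D <;> simp [E, E', q, Fin.sum_univ_two] <;> norm_num

theorem star_E (A B : Fin 2) : star (D.E A B) = D.E A B := by
  cases D <;> fin_cases A <;> fin_cases B <;> simp [E]

theorem star_E' (A B : Fin 2) : star (D.E' A B) = D.E' A B := by
  cases D <;> fin_cases A <;> fin_cases B <;> simp [E']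

theorem q_mul_q : D.q * D.q = 1 := by cases D <;> simp [q]

theorem star_q : star D.q = D.q := by cases D <;> simp [q]

theorem qh_mul_qh : D.qh * D.qh = D.q := by cases D <;> simp [q, qh]

theorem star_qh : star D.qh = D.q * D.qh := by cases D <;> simp [q, qh]

theorem star_Q (p k : I2) : star (D.Q p k) = D.q * D.Q p.swap k.swap := by
  obtain ⟨a, b⟩ := p
  obtain ⟨c, d⟩ := k
  cases D <;> fin_cases a <;> fin_cases b <;> fin_cases c <;> fin_cases d <;>
    simp [Q, Q4, q, finProdFinEquiv]

theorem isUnit_Q4 : ∃ M : Matrix (Fin 4) (Fin 4) ℂ, D.Q4 * M = 1 := by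
  cases D with
  | type1 t ht _ =>
    have ht : (t : ℂ) ≠ 0 := by exact_mod_cast ht.ne'
    refine ⟨!![(t : ℂ), 0, 0, 0; 0, (t : ℂ)⁻¹, 0, 0; 0, 0, (t : ℂ)⁻¹, 0; 0, 0, 0, (t : ℂ)], ?_⟩
    ext i j
    fin_cases i <;> fin_cases j <;> simp [Q4, Matrix.mul_apply, Fin.sum_univ_four, ht]
  | type2 c _ =>
    refine ⟨!![1, 0, 0, -(c : ℂ) ^ 2; 0, 1, 0, 0; 0, 0, 1, 0; 0, 0, 0, 1], ?_⟩
    ext i j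
    fin_cases i <;> fin_cases j <;> simp [Q4, Matrix.mul_apply, Fin.sum_univ_four]
  | type3 c _ r _ =>
    refine ⟨!![1, 0, 0, -((r : ℂ) * (c : ℂ) ^ 2); 0, 1, 0, 0; 0, 0, 1, 0; 0, 0, 0, 1], ?_⟩
    ext i j
    fin_cases i <;> fin_cases j <;> simp [Q4, Matrix.mul_apply, Fin.sum_univ_four]
  | type4 c _ =>
    refine ⟨!![1, -(c : ℂ), -(c : ℂ), -2 * (c : ℂ) ^ 2; 0, 1, 0, (c : ℂ); 0, 0, 1, (c : ℂ);
      0, 0, 0, 1], ?_⟩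
    ext i j
    fin_cases i <;> fin_cases j <;> simp [Q4, Matrix.mul_apply, Fin.sum_univ_four]
    ring
  | type5 t ht _ =>
    have ht : (t : ℂ) ≠ 0 := by exact_mod_cast ht.ne'
    refine ⟨(-Complex.I) • !![(t : ℂ), 0, 0, 0; 0, -(t : ℂ)⁻¹, 0, 0; 0, 0, -(t : ℂ)⁻¹, 0;
      0, 0, 0, (t : ℂ)], ?_⟩
    rw [Q4, Matrix.smul_mul, Matrix.mul_smul, smul_smul]
    ext i j
    fin_cases i <;> fin_cases j <;> simp [ht]
  | type6 c _ =>
    refine ⟨(-Complex.I) • !![1, 0, 0, -(c : ℂ) ^ 2; 0, -1, 0, 0; 0, 0, -1, 0; 0, 0, 0, 1], ?_⟩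
    rw [Q4, Matrix.smul_mul, Matrix.mul_smul, smul_smul]
    ext i j
    fin_cases i <;> fin_cases j <;> simp
  | type7 t ht _ =>
    have ht : (t : ℂ) ≠ 0 := by exact_mod_cast ht.ne'
    refine ⟨let r : ℂ := ((t : ℂ) + (t : ℂ)⁻¹) / 2
      let z : ℂ := ((t : ℂ) - (t : ℂ)⁻¹) / 2
      (-Complex.I) • !![r, 0, 0, -z; 0, -r, -z, 0; 0, -z, -r, 0; -z, 0, 0, r], ?_⟩
    simp only [Q4, Matrix.smul_mul, Matrix.mul_smul, smul_smul]
    ext i j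
    fin_cases i <;> fin_cases j <;> simp <;>
      field_simp <;> ring

theorem isUnit_X : IsUnit D.X := by
  obtain ⟨M, hM⟩ := D.isUnit_Q4
  have h1 : D.Q * M.submatrix (finProdFinEquiv : I2 ≃ Fin (2 * 2))
      (finProdFinEquiv : I2 ≃ Fin (2 * 2)) = 1 := by
    rw [Q, Matrix.submatrix_mul_equiv]
    exact (congrArg (fun N => Matrix.submatrix N _ _) hM).trans (Matrix.submatrix_one_equiv _)
  set M' := M.submatrix (finProdFinEquiv : I2 ≃ Fin (2 * 2)) (finProdFinEquiv : I2 ≃ Fin (2 * 2))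
  have h2 : D.X * M'.submatrix id (Equiv.prodComm (Fin 2) (Fin 2)) = 1 := by
    have : D.X = D.Q.submatrix (Equiv.prodComm (Fin 2) (Fin 2)) (Equiv.refl _) := rfl
    rw [this]
    have e := Matrix.submatrix_mul_equiv D.Q M' (Equiv.prodComm (Fin 2) (Fin 2))
      (Equiv.refl _) (Equiv.prodComm (Fin 2) (Fin 2))
    refine Eq.trans ?_ (e.trans ?_)
    · rfl
    · rw [h1]; exact Matrix.submatrix_one_equiv _
  exact IsUnit.of_mul_eq_one _ h2

theorem X_mul_inv : D.X * D.X⁻¹ = 1 :=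
  Matrix.mul_nonsing_inv _ ((Matrix.isUnit_iff_isUnit_det _).1 D.isUnit_X)

theorem inv_mul_X : D.X⁻¹ * D.X = 1 :=
  Matrix.nonsing_inv_mul _ ((Matrix.isUnit_iff_isUnit_det _).1 D.isUnit_X)

/-- `conj X = q τ X τ`. -/
theorem star_X : D.X.map star = D.q • D.X.submatrix Prod.swap Prod.swap := by
  ext p k
  simpa [X] using D.star_Q p.swap k

/-- `conj X⁻¹ = q τ X⁻¹ τ`. -/
theorem star_Xinv : D.X⁻¹.map star = D.q • D.X⁻¹.submatrix Prod.swap Prod.swap := by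
  have h1 : D.X.map star * D.X⁻¹.map star = 1 := by
    have := congrArg (fun M : Matrix I2 I2 ℂ => M.map (starRingEnd ℂ)) D.X_mul_inv
    simpa [Matrix.map_mul] using this
  have h2 : (D.q • D.X⁻¹.submatrix Prod.swap Prod.swap) * D.X.map star = 1 := by
    rw [star_X, Matrix.smul_mul, Matrix.mul_smul, smul_smul, q_mul_q, one_smul]
    have e := Matrix.submatrix_mul_equiv D.X⁻¹ D.X (Equiv.prodComm (Fin 2) (Fin 2))
      (Equiv.prodComm (Fin 2) (Fin 2)) (Equiv.prodComm (Fin 2) (Fin 2))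
    refine Eq.trans ?_ (e.trans ?_)
    · rfl
    · rw [inv_mul_X]; exact Matrix.submatrix_one_equiv _
  exact (left_inv_eq_right_inv h2 h1).symm

end LorentzType

namespace PoincareData

variable (P : PoincareData)

theorem s_mul_s : P.s * P.s = 1 := by rcases P.s_eq with h | h <;> simp [h]

theorem star_s : star P.s = P.s := by rcases P.s_eq with h | h <;> simp [h]

/-- `L² = q`. -/
theorem L_mul_L : P.L * P.L = P.lorentz.q • (1 : Matrix I2 I2 ℂ) := by
  set N : Matrix I2 I2 ℂ :=
    Matrix.of fun p k => P.lorentz.E p.1 p.2 * P.lorentz.E' k.1 k.2 with hN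
  have hNN : N * N = (-2 * P.lorentz.q) • N := by
    ext p k
    rw [← LorentzType.sum_E'_E, Matrix.mul_apply, Fintype.sum_prod_type]
    simp only [hN, Matrix.of_apply, Matrix.smul_apply, smul_eq_mul, Finset.sum_mul]
    refine Finset.sum_congr rfl fun a _ => Finset.sum_congr rfl fun b _ => ?_
    ring
  have h1 : P.L = (P.s * P.lorentz.qh) • (1 + P.lorentz.q • N) := rfl
  rw [h1, Matrix.smul_mul, Matrix.mul_smul, smul_smul]
  have h2 : (1 + P.lorentz.q • N) * (1 + P.lorentz.q • N) = 1 := by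
    rw [add_mul, mul_add, mul_add, one_mul, mul_one, one_mul, Matrix.smul_mul, Matrix.mul_smul, hNN,
      smul_smul, smul_smul]
    have : P.lorentz.q * P.lorentz.q * (-2 * P.lorentz.q) = -2 * P.lorentz.q := by
      linear_combination (-2 * P.lorentz.q) * P.lorentz.q_mul_q
    rw [this, add_assoc, ← add_smul, ← add_smul]
    have h0 : P.lorentz.q + (P.lorentz.q + -2 * P.lorentz.q) = 0 := by ring
    rw [h0, zero_smul, add_zero]
  rw [h2]
  congr 1
  linear_combination P.lorentz.qh_mul_qh + P.lorentz.qh * P.lorentz.qh * P.s_mul_s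

end PoincareData

theorem mid_eq (M : Matrix I2 I2 ℂ) :
    mid M = ((1 : Matrix (Fin 2) (Fin 2) ℂ) ⊗ₖ (M ⊗ₖ (1 : Matrix (Fin 2) (Fin 2) ℂ))).submatrix
      (fun p : I2 × I2 => (p.1.1, ((p.1.2, p.2.1), p.2.2)))
      (fun p : I2 × I2 => (p.1.1, ((p.1.2, p.2.1), p.2.2))) := by
  ext p k
  by_cases h1 : p.1.1 = k.1.1 <;> by_cases h2 : p.2.2 = k.2.2 <;>
    simp [mid, h1, h2]

/-- Regrouping of four indices. -/
def e3 : Fin 2 × (I2 × Fin 2) ≃ I2 × I2 where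
  toFun p := ((p.1, p.2.1.1), (p.2.1.2, p.2.2))
  invFun p := (p.1.1, ((p.1.2, p.2.1), p.2.2))
  left_inv _ := rfl
  right_inv _ := rfl

theorem mid_eq' (M : Matrix I2 I2 ℂ) :
    mid M = ((1 : Matrix (Fin 2) (Fin 2) ℂ) ⊗ₖ (M ⊗ₖ (1 : Matrix (Fin 2) (Fin 2) ℂ))).submatrix
      e3.symm e3.symm := mid_eq M

theorem mid_mul (M N : Matrix I2 I2 ℂ) : mid M * mid N = mid (M * N) := by
  rw [mid_eq', mid_eq', Matrix.submatrix_mul_equiv, ← Matrix.mul_kronecker_mul,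
    ← Matrix.mul_kronecker_mul, Matrix.mul_one, ← mid_eq']

theorem mid_one : mid (1 : Matrix I2 I2 ℂ) = 1 := by
  rw [mid_eq', Matrix.one_kronecker_one, Matrix.one_kronecker_one, Matrix.submatrix_one_equiv]

namespace PoincareData

variable (P : PoincareData)

theorem L_inv : P.L⁻¹ = P.lorentz.q • P.L := by
  refine Matrix.inv_eq_right_inv ?_
  rw [Matrix.mul_smul, L_mul_L, smul_smul, LorentzType.q_mul_q, one_smul]

theorem star_L : P.L.map star = P.lorentz.q • P.L := by
  ext p k
  have h1 : ∀ z : ℂ, (starRingEnd ℂ) z = star z := fun _ => rfl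
  by_cases h : p = k
  · simp [L, h1, star_s, LorentzType.star_qh, LorentzType.star_q, LorentzType.star_E,
      LorentzType.star_E', h]
    ring
  · simp [L, h1, star_s, LorentzType.star_qh, LorentzType.star_q, LorentzType.star_E,
      LorentzType.star_E', h]
    ring

theorem Lt_mul_Lt : P.Lt * P.Lt = P.lorentz.q • (1 : Matrix I2 I2 ℂ) := by
  have h := congrArg (fun M : Matrix I2 I2 ℂ => M.submatrix (Equiv.prodComm (Fin 2) (Fin 2))
    (Equiv.prodComm (Fin 2) (Fin 2))) P.L_mul_L
  simp only [← Matrix.submatrix_mul_equiv _ _ _ (Equiv.prodComm (Fin 2) (Fin 2))] at h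
  have h2 : P.Lt = P.lorentz.q • P.L.submatrix (Equiv.prodComm (Fin 2) (Fin 2))
    (Equiv.prodComm (Fin 2) (Fin 2)) := rfl
  rw [h2, Matrix.smul_mul, Matrix.mul_smul, smul_smul, LorentzType.q_mul_q, one_smul, h]
  ext p k
  simp [Matrix.one_apply]

/-- `R² = 1`. -/
theorem R_mul_R : P.R * P.R = 1 := by
  have hV : (V ⊗ₖ V) * (Vi ⊗ₖ Vi) = 1 := by
    rw [← Matrix.mul_kronecker_mul, V_mul_Vi, Matrix.one_kronecker_one]
  have hVi : (Vi ⊗ₖ Vi) * (V ⊗ₖ V) = 1 := by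
    rw [← Matrix.mul_kronecker_mul, Vi_mul_V, Matrix.one_kronecker_one]
  have hX : mid P.lorentz.X⁻¹ * mid P.lorentz.X = 1 := by
    rw [mid_mul, LorentzType.inv_mul_X, mid_one]
  have hX' : mid P.lorentz.X * mid P.lorentz.X⁻¹ = 1 := by
    rw [mid_mul, LorentzType.X_mul_inv, mid_one]
  have hL : (P.L ⊗ₖ P.Lt) * (P.L ⊗ₖ P.Lt) = 1 := by
    rw [← Matrix.mul_kronecker_mul, L_mul_L, Lt_mul_Lt, Matrix.smul_kronecker,
      Matrix.kronecker_smul, smul_smul, LorentzType.q_mul_q, one_smul, Matrix.one_kronecker_one]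
  calc P.R * P.R = (Vi ⊗ₖ Vi) * mid P.lorentz.X * (P.L ⊗ₖ P.Lt) * (mid P.lorentz.X⁻¹ *
      (((V ⊗ₖ V) * (Vi ⊗ₖ Vi)) * mid P.lorentz.X)) * (P.L ⊗ₖ P.Lt) * mid P.lorentz.X⁻¹ *
        (V ⊗ₖ V) := by simp only [R, Matrix.mul_assoc]
    _ = (Vi ⊗ₖ Vi) * (mid P.lorentz.X * (((P.L ⊗ₖ P.Lt) * (P.L ⊗ₖ P.Lt)) * mid P.lorentz.X⁻¹)) *
        (V ⊗ₖ V) := by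
      rw [hV, Matrix.one_mul, hX, Matrix.mul_one]; simp only [Matrix.mul_assoc]
    _ = 1 := by rw [hL, Matrix.one_mul, hX', Matrix.mul_one, hVi]

/-- `G~ = (V⁻¹ ⊗ 1)(1 ⊗ L~)(X⁻¹ ⊗ 1)(1 ⊗ V)`, which describes the commutation of `y` and `w̄`. -/
def Gt : Matrix (Fin 4 × Fin 2) (Fin 2 × Fin 4) ℂ :=
  (Vi ⊗ₖ (1 : Matrix (Fin 2) (Fin 2) ℂ)) *
    rowAssoc (colAssoc ((1 : Matrix (Fin 2) (Fin 2) ℂ) ⊗ₖ P.Lt)) *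
    (P.lorentz.X⁻¹ ⊗ₖ (1 : Matrix (Fin 2) (Fin 2) ℂ)) *
    rowAssoc ((1 : Matrix (Fin 2) (Fin 2) ℂ) ⊗ₖ V)

end PoincareData

/-- The flip of three indices. -/
def flip3 : I2 × Fin 2 ≃ I2 × Fin 2 where
  toFun p := ((p.2, p.1.2), p.1.1)
  invFun p := ((p.2, p.1.2), p.1.1)
  left_inv _ := rfl
  right_inv _ := rfl

theorem star_pauli (i : Fin 4) (a b : Fin 2) : star (pauli i a b) = pauli i b a := by
  fin_cases i <;> fin_cases a <;> fin_cases b <;> simp [pauli]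

theorem star_V (p : I2) (i : Fin 4) : star (V p i) = V p.swap i := star_pauli _ _ _

theorem star_Vi (i : Fin 4) (p : I2) : star (Vi i p) = Vi i p.swap := by
  simp [Vi, ← starRingEnd_apply]
  simp [star_pauli, starRingEnd_apply]

namespace PoincareData

variable (P : PoincareData)

theorem Gt_eq : P.Gt = (P.Gi.map star).submatrix Prod.swap Prod.swap := by
  have h1 : ∀ z : ℂ, (starRingEnd ℂ) z = star z := fun _ => rfl
  have f1 : ((colAssoc ((1 : Matrix (Fin 2) (Fin 2) ℂ) ⊗ₖ Vi)).map (starRingEnd ℂ)).submatrix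
      (Equiv.prodComm (Fin 4) (Fin 2)) flip3 = Vi ⊗ₖ (1 : Matrix (Fin 2) (Fin 2) ℂ) := by
    ext ⟨i, a⟩ ⟨⟨b, c⟩, d⟩
    by_cases h : a = d <;> simp [colAssoc, flip3, h, h1, star_Vi]
  have f4 : ((V ⊗ₖ (1 : Matrix (Fin 2) (Fin 2) ℂ)).map (starRingEnd ℂ)).submatrix
      flip3 (Equiv.prodComm (Fin 2) (Fin 4)) =
        rowAssoc ((1 : Matrix (Fin 2) (Fin 2) ℂ) ⊗ₖ V) := by
    ext ⟨⟨b, c⟩, d⟩ ⟨a, i⟩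
    by_cases h : b = a <;> simp [rowAssoc, flip3, h, h1, star_V]
  have f2 : ((P.L⁻¹ ⊗ₖ (1 : Matrix (Fin 2) (Fin 2) ℂ)).map (starRingEnd ℂ)).submatrix
      flip3 flip3 =
      P.lorentz.q • rowAssoc (colAssoc ((1 : Matrix (Fin 2) (Fin 2) ℂ) ⊗ₖ P.Lt)) := by
    have key : ∀ p k, star (P.L⁻¹ p k) = P.lorentz.q * P.Lt p.swap k.swap := by
      intro p k
      have hs : star (P.L p k) = P.lorentz.q * P.L p k := congrFun (congrFun P.star_L p) k
      rw [L_inv, Matrix.smul_apply, smul_eq_mul, star_mul, LorentzType.star_q, hs]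
      simp [Lt]
      ring
    ext ⟨⟨b, c⟩, d⟩ ⟨⟨b', c'⟩, d'⟩
    by_cases h : b = b' <;> simp [rowAssoc, colAssoc, flip3, h, h1, key]
  have f3 : ((rowAssoc (colAssoc ((1 : Matrix (Fin 2) (Fin 2) ℂ) ⊗ₖ P.lorentz.X⁻¹))).map
      (starRingEnd ℂ)).submatrix flip3 flip3 =
      P.lorentz.q • (P.lorentz.X⁻¹ ⊗ₖ (1 : Matrix (Fin 2) (Fin 2) ℂ)) := by
    have key : ∀ p k, star (P.lorentz.X⁻¹ p k) = P.lorentz.q * P.lorentz.X⁻¹ p.swap k.swap :=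
      fun p k => congrFun (congrFun P.lorentz.star_Xinv p) k
    ext ⟨⟨b, c⟩, d⟩ ⟨⟨b', c'⟩, d'⟩
    by_cases h : d = d' <;> simp [rowAssoc, colAssoc, flip3, h, h1, key]
  have e : (P.Gi.map star).submatrix Prod.swap Prod.swap =
      (P.Gi.map (starRingEnd ℂ)).submatrix (Equiv.prodComm (Fin 4) (Fin 2))
        (Equiv.prodComm (Fin 2) (Fin 4)) := rfl
  rw [e, Gi, Matrix.map_mul, Matrix.map_mul, Matrix.map_mul,
    ← Matrix.submatrix_mul_equiv _ _ _ flip3, ← Matrix.submatrix_mul_equiv _ _ _ flip3,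
    ← Matrix.submatrix_mul_equiv _ _ _ flip3, f1, f2, f3, f4, Gt]
  simp only [Matrix.mul_smul, Matrix.smul_mul, smul_smul, LorentzType.q_mul_q, one_smul]

end PoincareData

/-- Regrouping of four indices. -/
def e2 : (Fin 2 × I2) × Fin 2 ≃ I2 × I2 where
  toFun p := ((p.1.1, p.1.2.1), (p.1.2.2, p.2))
  invFun p := ((p.1.1, (p.1.2, p.2.1)), p.2.2)
  left_inv _ := rfl
  right_inv _ := rfl

/-- Regrouping of four indices. -/
abbrev e1 : (I2 × Fin 2) × Fin 2 ≃ I2 × I2 := Equiv.prodAssoc I2 (Fin 2) (Fin 2)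

namespace PoincareData

variable (P : PoincareData)

/-- `R` is the matrix which moves `y` through `w ⊗ w̄`. -/
theorem R_eq : P.R = colAssoc ((1 : Matrix (Fin 4) (Fin 4) ℂ) ⊗ₖ Vi) *
    ((P.G ⊗ₖ (1 : Matrix (Fin 2) (Fin 2) ℂ)) *
      rowAssoc (colAssoc ((1 : Matrix (Fin 2) (Fin 2) ℂ) ⊗ₖ P.Gt))) *
    (V ⊗ₖ (1 : Matrix (Fin 4) (Fin 4) ℂ)) := by
  have F1 : colAssoc ((1 : Matrix (Fin 4) (Fin 4) ℂ) ⊗ₖ Vi) *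
      ((Vi ⊗ₖ (1 : Matrix (Fin 2) (Fin 2) ℂ)) ⊗ₖ (1 : Matrix (Fin 2) (Fin 2) ℂ)) =
      (Vi ⊗ₖ Vi).submatrix id e1 := by
    have h : (Vi ⊗ₖ (1 : Matrix (Fin 2) (Fin 2) ℂ)) ⊗ₖ (1 : Matrix (Fin 2) (Fin 2) ℂ) =
        (Vi ⊗ₖ (1 : Matrix I2 I2 ℂ)).submatrix (Equiv.prodAssoc (Fin 4) (Fin 2) (Fin 2)) e1 := by
      ext ⟨⟨i, a⟩, b⟩ ⟨⟨p, a'⟩, b'⟩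
      by_cases h1 : a = a' <;> by_cases h2 : b = b' <;> simp [h1, h2]
    rw [h, colAssoc, Matrix.submatrix_mul_equiv, ← Matrix.mul_kronecker_mul, Matrix.one_mul,
      Matrix.mul_one]
  have F2 : rowAssoc (colAssoc ((1 : Matrix (Fin 2) (Fin 2) ℂ) ⊗ₖ P.lorentz.X)) ⊗ₖ
      (1 : Matrix (Fin 2) (Fin 2) ℂ) = (mid P.lorentz.X).submatrix e1 e1 := by
    ext ⟨⟨⟨a, b⟩, c⟩, d⟩ ⟨⟨⟨a', b'⟩, c'⟩, d'⟩
    by_cases h1 : a = a' <;> by_cases h2 : d = d' <;>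
      simp [rowAssoc, colAssoc, mid, h1, h2]
  have F3 : (P.L ⊗ₖ (1 : Matrix (Fin 2) (Fin 2) ℂ)) ⊗ₖ (1 : Matrix (Fin 2) (Fin 2) ℂ) =
      (P.L ⊗ₖ (1 : Matrix I2 I2 ℂ)).submatrix e1 e1 := by
    ext ⟨⟨p, c⟩, d⟩ ⟨⟨p', c'⟩, d'⟩
    by_cases h1 : c = c' <;> by_cases h2 : d = d' <;> simp [h1, h2]
  have F4 : (rowAssoc ((1 : Matrix (Fin 2) (Fin 2) ℂ) ⊗ₖ V) ⊗ₖ (1 : Matrix (Fin 2) (Fin 2) ℂ)) *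
      (rowAssoc ((1 : Matrix (Fin 2) (Fin 2) ℂ) ⊗ₖ (Vi ⊗ₖ (1 : Matrix (Fin 2) (Fin 2) ℂ)))) =
      (1 : Matrix (I2 × I2) (I2 × I2) ℂ).submatrix e1 e3 := by
    have h : rowAssoc ((1 : Matrix (Fin 2) (Fin 2) ℂ) ⊗ₖ V) ⊗ₖ (1 : Matrix (Fin 2) (Fin 2) ℂ) =
        ((1 : Matrix (Fin 2) (Fin 2) ℂ) ⊗ₖ (V ⊗ₖ (1 : Matrix (Fin 2) (Fin 2) ℂ))).submatrix
          (e1.trans e3.symm) (Equiv.prodAssoc (Fin 2) (Fin 4) (Fin 2)) := by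
      ext ⟨⟨⟨a, b⟩, c⟩, d⟩ ⟨⟨a', i⟩, d'⟩
      by_cases h1 : a = a' <;> by_cases h2 : d = d' <;> simp [rowAssoc, e3, h1, h2]
    rw [h, rowAssoc, Matrix.submatrix_mul_equiv, ← Matrix.mul_kronecker_mul,
      ← Matrix.mul_kronecker_mul, Matrix.one_mul, V_mul_Vi,
      Matrix.one_kronecker_one, Matrix.one_kronecker_one]
    ext p k
    simp [Matrix.one_apply, Equiv.symm_apply_eq]
  have F5 : (1 : Matrix (Fin 2) (Fin 2) ℂ) ⊗ₖ
      rowAssoc (colAssoc ((1 : Matrix (Fin 2) (Fin 2) ℂ) ⊗ₖ P.Lt)) =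
      ((1 : Matrix I2 I2 ℂ) ⊗ₖ P.Lt).submatrix e3 e3 := by
    ext ⟨a, ⟨⟨b, c⟩, d⟩⟩ ⟨a', ⟨⟨b', c'⟩, d'⟩⟩
    by_cases h1 : a = a' <;> by_cases h2 : b = b' <;>
      simp [rowAssoc, colAssoc, e3, h1, h2]
  have F6 : (1 : Matrix (Fin 2) (Fin 2) ℂ) ⊗ₖ
      (P.lorentz.X⁻¹ ⊗ₖ (1 : Matrix (Fin 2) (Fin 2) ℂ)) =
      (mid P.lorentz.X⁻¹).submatrix e3 e3 := by
    rw [mid_eq', Matrix.submatrix_submatrix]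
    simp
  have F7 : colAssoc ((1 : Matrix (Fin 2) (Fin 2) ℂ) ⊗ₖ
      rowAssoc ((1 : Matrix (Fin 2) (Fin 2) ℂ) ⊗ₖ V)) * (V ⊗ₖ (1 : Matrix (Fin 4) (Fin 4) ℂ)) =
      (V ⊗ₖ V).submatrix e3 id := by
    have h : colAssoc ((1 : Matrix (Fin 2) (Fin 2) ℂ) ⊗ₖ
        rowAssoc ((1 : Matrix (Fin 2) (Fin 2) ℂ) ⊗ₖ V)) =
        ((1 : Matrix I2 I2 ℂ) ⊗ₖ V).submatrix e3 (Equiv.refl _) := by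
      ext ⟨a, ⟨⟨b, c⟩, d⟩⟩ ⟨⟨a', b'⟩, i⟩
      by_cases h1 : a = a' <;> by_cases h2 : b = b' <;>
        simp [rowAssoc, colAssoc, e3, h1, h2]
    have h' : (V ⊗ₖ (1 : Matrix (Fin 4) (Fin 4) ℂ)) =
        (V ⊗ₖ (1 : Matrix (Fin 4) (Fin 4) ℂ)).submatrix (Equiv.refl _) id := rfl
    rw [h, h', Matrix.submatrix_mul_equiv, ← Matrix.mul_kronecker_mul, Matrix.one_mul,
      Matrix.mul_one]
  have hG : P.G ⊗ₖ (1 : Matrix (Fin 2) (Fin 2) ℂ) =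
      ((Vi ⊗ₖ (1 : Matrix (Fin 2) (Fin 2) ℂ)) ⊗ₖ (1 : Matrix (Fin 2) (Fin 2) ℂ)) *
      ((mid P.lorentz.X).submatrix e1 e1 * (P.L ⊗ₖ (1 : Matrix I2 I2 ℂ)).submatrix e1 e1) *
      (rowAssoc ((1 : Matrix (Fin 2) (Fin 2) ℂ) ⊗ₖ V) ⊗ₖ (1 : Matrix (Fin 2) (Fin 2) ℂ)) := by
    rw [← F2, ← F3, ← Matrix.mul_kronecker_mul, ← Matrix.mul_kronecker_mul,
      ← Matrix.mul_kronecker_mul]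
    simp only [Matrix.mul_one, G, Matrix.mul_assoc]
  have hGt : rowAssoc (colAssoc ((1 : Matrix (Fin 2) (Fin 2) ℂ) ⊗ₖ P.Gt)) =
      (rowAssoc ((1 : Matrix (Fin 2) (Fin 2) ℂ) ⊗ₖ (Vi ⊗ₖ (1 : Matrix (Fin 2) (Fin 2) ℂ)))) *
      (((1 : Matrix I2 I2 ℂ) ⊗ₖ P.Lt).submatrix e3 e3 * (mid P.lorentz.X⁻¹).submatrix e3 e3) *
      colAssoc ((1 : Matrix (Fin 2) (Fin 2) ℂ) ⊗ₖ
        rowAssoc ((1 : Matrix (Fin 2) (Fin 2) ℂ) ⊗ₖ V)) := by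
    rw [← F5, ← F6, ← Matrix.mul_kronecker_mul, rowAssoc, rowAssoc, colAssoc, colAssoc]
    have e : ((1 : Matrix (Fin 2) (Fin 2) ℂ) ⊗ₖ P.Gt) =
        ((1 : Matrix (Fin 2) (Fin 2) ℂ) ⊗ₖ (Vi ⊗ₖ (1 : Matrix (Fin 2) (Fin 2) ℂ))) *
        ((1 * 1 : Matrix (Fin 2) (Fin 2) ℂ) ⊗ₖ
          (rowAssoc (colAssoc ((1 : Matrix (Fin 2) (Fin 2) ℂ) ⊗ₖ P.Lt)) *
            (P.lorentz.X⁻¹ ⊗ₖ (1 : Matrix (Fin 2) (Fin 2) ℂ)))) *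
        ((1 : Matrix (Fin 2) (Fin 2) ℂ) ⊗ₖ rowAssoc ((1 : Matrix (Fin 2) (Fin 2) ℂ) ⊗ₖ V)) := by
      rw [← Matrix.mul_kronecker_mul, ← Matrix.mul_kronecker_mul]
      simp only [Matrix.mul_one, Gt, Matrix.mul_assoc]
    rw [e]
    ext p k
    rfl
  rw [hG, hGt]
  have c1 : ∀ (A1 : Matrix (Fin 4 × Fin 4) ((Fin 4 × Fin 2) × Fin 2) ℂ)
      (A2 : Matrix ((Fin 4 × Fin 2) × Fin 2) ((I2 × Fin 2) × Fin 2) ℂ)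
      (A3 : Matrix ((I2 × Fin 2) × Fin 2) ((I2 × Fin 2) × Fin 2) ℂ)
      (A4 : Matrix ((I2 × Fin 2) × Fin 2) ((Fin 2 × Fin 4) × Fin 2) ℂ)
      (A5 : Matrix ((Fin 2 × Fin 4) × Fin 2) (Fin 2 × (I2 × Fin 2)) ℂ)
      (A6 : Matrix (Fin 2 × (I2 × Fin 2)) (Fin 2 × (I2 × Fin 2)) ℂ)
      (A7 : Matrix (Fin 2 × (I2 × Fin 2)) (I2 × Fin 4) ℂ)
      (A8 : Matrix (I2 × Fin 4) (Fin 4 × Fin 4) ℂ),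
      A1 * ((A2 * A3 * A4) * (A5 * A6 * A7)) * A8 = (A1 * A2) * A3 * (A4 * A5) * A6 * (A7 * A8) := by
    intros; simp only [Matrix.mul_assoc]
  refine Eq.trans ?_ (c1 _ _ _ _ _ _ _ _).symm
  rw [F1, F4, F7, Matrix.submatrix_mul_equiv, Matrix.submatrix_mul_equiv,
    Matrix.submatrix_mul_equiv, Matrix.submatrix_mul_equiv, Matrix.submatrix_mul_equiv,
    Matrix.submatrix_mul_equiv, Matrix.mul_one, R, Matrix.submatrix_id_id]
  have c2 : P.L ⊗ₖ P.Lt = (P.L ⊗ₖ (1 : Matrix I2 I2 ℂ)) * ((1 : Matrix I2 I2 ℂ) ⊗ₖ P.Lt) := by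
    rw [← Matrix.mul_kronecker_mul, Matrix.one_mul, Matrix.mul_one]
  rw [c2]
  simp only [Matrix.mul_assoc]

theorem L_mul_inv : P.L * P.L⁻¹ = 1 := by
  rw [L_inv, Matrix.mul_smul, L_mul_L, smul_smul, LorentzType.q_mul_q, one_smul]

theorem inv_mul_L : P.L⁻¹ * P.L = 1 := by
  rw [L_inv, Matrix.smul_mul, L_mul_L, smul_smul, LorentzType.q_mul_q, one_smul]

theorem asc_mul {M N : Matrix I2 I2 ℂ} (h : M * N = 1) :
    rowAssoc (colAssoc ((1 : Matrix (Fin 2) (Fin 2) ℂ) ⊗ₖ M)) *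
      rowAssoc (colAssoc ((1 : Matrix (Fin 2) (Fin 2) ℂ) ⊗ₖ N)) = 1 := by
  have e : ∀ K : Matrix I2 I2 ℂ, rowAssoc (colAssoc ((1 : Matrix (Fin 2) (Fin 2) ℂ) ⊗ₖ K)) =
      ((1 : Matrix (Fin 2) (Fin 2) ℂ) ⊗ₖ K).submatrix (Equiv.prodAssoc _ _ _)
        (Equiv.prodAssoc _ _ _) := fun _ => rfl
  rw [e, e, Matrix.submatrix_mul_equiv, ← Matrix.mul_kronecker_mul, h, Matrix.one_mul,
    Matrix.one_kronecker_one, Matrix.submatrix_one_equiv]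

theorem row_col_V : rowAssoc ((1 : Matrix (Fin 2) (Fin 2) ℂ) ⊗ₖ V) *
    colAssoc ((1 : Matrix (Fin 2) (Fin 2) ℂ) ⊗ₖ Vi) = 1 := by
  have e : rowAssoc ((1 : Matrix (Fin 2) (Fin 2) ℂ) ⊗ₖ V) =
    ((1 : Matrix (Fin 2) (Fin 2) ℂ) ⊗ₖ V).submatrix (Equiv.prodAssoc _ _ _) (Equiv.refl _) := rfl
  have e' : colAssoc ((1 : Matrix (Fin 2) (Fin 2) ℂ) ⊗ₖ Vi) =
    ((1 : Matrix (Fin 2) (Fin 2) ℂ) ⊗ₖ Vi).submatrix (Equiv.refl _) (Equiv.prodAssoc _ _ _) := rfl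
  rw [e, e', Matrix.submatrix_mul_equiv, ← Matrix.mul_kronecker_mul, V_mul_Vi, Matrix.one_mul,
    Matrix.one_kronecker_one, Matrix.submatrix_one_equiv]

theorem col_row_V : colAssoc ((1 : Matrix (Fin 2) (Fin 2) ℂ) ⊗ₖ Vi) *
    rowAssoc ((1 : Matrix (Fin 2) (Fin 2) ℂ) ⊗ₖ V) = 1 := by
  rw [rowAssoc, colAssoc, Matrix.submatrix_mul_equiv, ← Matrix.mul_kronecker_mul, Vi_mul_V,
    Matrix.one_mul, Matrix.one_kronecker_one, Matrix.submatrix_id_id]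

theorem G_mul_Gi : P.G * P.Gi = 1 := by
  have h1 := row_col_V
  have h2 : (P.L ⊗ₖ (1 : Matrix (Fin 2) (Fin 2) ℂ)) *
      (P.L⁻¹ ⊗ₖ (1 : Matrix (Fin 2) (Fin 2) ℂ)) = 1 := by
    rw [← Matrix.mul_kronecker_mul, L_mul_inv, Matrix.one_mul, Matrix.one_kronecker_one]
  have h3 := asc_mul P.lorentz.X_mul_inv
  have h4 : (Vi ⊗ₖ (1 : Matrix (Fin 2) (Fin 2) ℂ)) *
      (V ⊗ₖ (1 : Matrix (Fin 2) (Fin 2) ℂ)) = 1 := by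
    rw [← Matrix.mul_kronecker_mul, Vi_mul_V, Matrix.one_mul, Matrix.one_kronecker_one]
  rw [G, Gi]
  simp only [Matrix.mul_assoc]
  rw [← Matrix.mul_assoc (rowAssoc ((1 : Matrix (Fin 2) (Fin 2) ℂ) ⊗ₖ V)), h1, Matrix.one_mul,
    ← Matrix.mul_assoc (P.L ⊗ₖ (1 : Matrix (Fin 2) (Fin 2) ℂ)), h2, Matrix.one_mul,
    ← Matrix.mul_assoc (rowAssoc (colAssoc ((1 : Matrix (Fin 2) (Fin 2) ℂ) ⊗ₖ P.lorentz.X))), h3,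
    Matrix.one_mul, h4]

theorem Gi_mul_G : P.Gi * P.G = 1 := by
  have h1 := col_row_V
  have h2 : (P.L⁻¹ ⊗ₖ (1 : Matrix (Fin 2) (Fin 2) ℂ)) *
      (P.L ⊗ₖ (1 : Matrix (Fin 2) (Fin 2) ℂ)) = 1 := by
    rw [← Matrix.mul_kronecker_mul, inv_mul_L, Matrix.one_mul, Matrix.one_kronecker_one]
  have h3 := asc_mul P.lorentz.inv_mul_X
  have h4 : (V ⊗ₖ (1 : Matrix (Fin 2) (Fin 2) ℂ)) *
      (Vi ⊗ₖ (1 : Matrix (Fin 2) (Fin 2) ℂ)) = 1 := by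
    rw [← Matrix.mul_kronecker_mul, V_mul_Vi, Matrix.one_mul, Matrix.one_kronecker_one]
  rw [G, Gi]
  simp only [Matrix.mul_assoc]
  rw [← Matrix.mul_assoc (V ⊗ₖ (1 : Matrix (Fin 2) (Fin 2) ℂ)), h4, Matrix.one_mul,
    ← Matrix.mul_assoc (rowAssoc (colAssoc ((1 : Matrix (Fin 2) (Fin 2) ℂ) ⊗ₖ P.lorentz.X⁻¹))), h3,
    Matrix.one_mul, ← Matrix.mul_assoc (P.L⁻¹ ⊗ₖ (1 : Matrix (Fin 2) (Fin 2) ℂ)), h2,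
    Matrix.one_mul, h1]

end PoincareData

theorem kron_assoc {S : Type*} [Ring S] {a b c a' b' c' : Type*} (u : Matrix a a' S) (v : Matrix b b' S) (t : Matrix c c' S) :
    (u ⊗ₖ v) ⊗ₖ t = (u ⊗ₖ (v ⊗ₖ t)).submatrix (Equiv.prodAssoc a b c)
      (Equiv.prodAssoc a' b' c') := by
  ext ⟨⟨i, j⟩, k⟩ ⟨⟨i', j'⟩, k'⟩
  simp [mul_assoc]

/-- Multiplication by a translation coordinate from the left. -/
def lY {S : Type*} [Ring S] {m n : Type*} (y : Fin 4 → S) (u : Matrix m n S) :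
    Matrix (Fin 4 × m) n S :=
  Matrix.of fun p j => y p.1 * u p.2 j

/-- Multiplication by a translation coordinate from the right. -/
def rY {S : Type*} [Ring S] {m n : Type*} (y : Fin 4 → S) (u : Matrix m n S) :
    Matrix (m × Fin 4) n S :=
  Matrix.of fun p j => u p.1 j * y p.2

section ScalarMat

variable {S : Type*} [Ring S] [Algebra ℂ S]

theorem scalarMat_mul {m n k : Type*} [Fintype n] (M : Matrix m n ℂ) (N : Matrix n k ℂ) :
    scalarMat S (M * N) = scalarMat S M * scalarMat S N :=
  Matrix.map_mul (f := algebraMap ℂ S)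

theorem scalarMat_one {m : Type*} [DecidableEq m] : scalarMat S (1 : Matrix m m ℂ) = 1 :=
  Matrix.map_one _ (map_zero _) (map_one _)

theorem scalarMat_add {m n : Type*} (M N : Matrix m n ℂ) :
    scalarMat S (M + N) = scalarMat S M + scalarMat S N := by
  ext; simp [scalarMat]

theorem scalarMat_smul {m n : Type*} (z : ℂ) (M : Matrix m n ℂ) :
    scalarMat S (z • M) = z • scalarMat S M := by
  ext; simp [scalarMat, Algebra.smul_def]

theorem scalarMat_sub {m n : Type*} (M N : Matrix m n ℂ) :
    scalarMat S (M - N) = scalarMat S M - scalarMat S N := by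
  ext; simp [scalarMat]

variable {a b c d e f : Type*}

theorem scalarMat_mul_apply [Fintype b] (M : Matrix a b ℂ) (u : Matrix b e S) (i : a) (j : e) :
    (scalarMat S M * u) i j = ∑ k, M i k • u k j := by
  simp [Matrix.mul_apply, scalarMat, Algebra.smul_def]

theorem mul_scalarMat_apply [Fintype b] (M : Matrix b e ℂ) (u : Matrix a b S) (i : a) (j : e) :
    (u * scalarMat S M) i j = ∑ k, M k j • u i k := by
  simp [Matrix.mul_apply, scalarMat, Algebra.smul_def, Algebra.commutes]

theorem scalarMat_kron_mul [Fintype b] [Fintype d] (M : Matrix a b ℂ) (N : Matrix c d ℂ) (u : Matrix b e S)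
    (v : Matrix d f S) :
    scalarMat S (M ⊗ₖ N) * (u ⊗ₖ v) = (scalarMat S M * u) ⊗ₖ (scalarMat S N * v) := by
  ext ⟨i, j⟩ ⟨k, l⟩
  rw [scalarMat_mul_apply, Matrix.kronecker_apply, scalarMat_mul_apply, scalarMat_mul_apply,
    Fintype.sum_prod_type, Finset.sum_mul_sum]
  simp only [smul_mul_smul_comm, Matrix.kronecker_apply]

theorem mul_scalarMat_kron [Fintype a] [Fintype c] (M : Matrix a b ℂ) (N : Matrix c d ℂ) (u : Matrix e a S)
    (v : Matrix f c S) :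
    (u ⊗ₖ v) * scalarMat S (M ⊗ₖ N) = (u * scalarMat S M) ⊗ₖ (v * scalarMat S N) := by
  ext ⟨i, j⟩ ⟨k, l⟩
  rw [mul_scalarMat_apply, Matrix.kronecker_apply, mul_scalarMat_apply, mul_scalarMat_apply,
    Fintype.sum_prod_type, Finset.sum_mul_sum]
  simp only [smul_mul_smul_comm, Matrix.kronecker_apply]

theorem one_kron_mul [Fintype b] [Fintype d] [DecidableEq b] (N : Matrix c d ℂ) (u : Matrix b e S) (v : Matrix d f S) :
    scalarMat S ((1 : Matrix b b ℂ) ⊗ₖ N) * (u ⊗ₖ v) = u ⊗ₖ (scalarMat S N * v) := by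
  rw [scalarMat_kron_mul, scalarMat_one, Matrix.one_mul]

theorem kron_one_mul [Fintype b] [Fintype d] [DecidableEq d] (M : Matrix a b ℂ) (u : Matrix b e S) (v : Matrix d f S) :
    scalarMat S (M ⊗ₖ (1 : Matrix d d ℂ)) * (u ⊗ₖ v) = (scalarMat S M * u) ⊗ₖ v := by
  rw [scalarMat_kron_mul, scalarMat_one, Matrix.one_mul]

theorem mul_one_kron [Fintype a] [Fintype c] [DecidableEq a] (N : Matrix c d ℂ) (u : Matrix e a S) (v : Matrix f c S) :
    (u ⊗ₖ v) * scalarMat S ((1 : Matrix a a ℂ) ⊗ₖ N) = u ⊗ₖ (v * scalarMat S N) := by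
  rw [mul_scalarMat_kron, scalarMat_one, Matrix.mul_one]

theorem mul_kron_one [Fintype a] [Fintype c] [DecidableEq c] (M : Matrix a b ℂ) (u : Matrix e a S) (v : Matrix f c S) :
    (u ⊗ₖ v) * scalarMat S (M ⊗ₖ (1 : Matrix c c ℂ)) = (u * scalarMat S M) ⊗ₖ v := by
  rw [mul_scalarMat_kron, scalarMat_one, Matrix.mul_one]

theorem scalarMat_submatrix {m n m' n' : Type*} (M : Matrix m n ℂ) (g : m' → m) (h : n' → n) :
    scalarMat S (M.submatrix g h) = (scalarMat S M).submatrix g h := rfl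

theorem lY_scalar_mul [Fintype b] (y : Fin 4 → S) (M : Matrix a b ℂ) (u : Matrix b e S) :
    lY y (scalarMat S M * u) = scalarMat S ((1 : Matrix (Fin 4) (Fin 4) ℂ) ⊗ₖ M) * lY y u := by
  ext ⟨i, j⟩ k
  simp [lY, scalarMat_mul_apply, Fintype.sum_prod_type, Matrix.one_apply, Finset.mul_sum]

theorem rY_scalar_mul [Fintype b] (y : Fin 4 → S) (M : Matrix a b ℂ) (u : Matrix b e S) :
    rY y (scalarMat S M * u) = scalarMat S (M ⊗ₖ (1 : Matrix (Fin 4) (Fin 4) ℂ)) * rY y u := by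
  ext ⟨i, j⟩ k
  simp [rY, scalarMat_mul_apply, Fintype.sum_prod_type, Matrix.one_apply, Finset.sum_mul]

theorem lY_mul_scalar [Fintype b] (y : Fin 4 → S) (M : Matrix b c ℂ) (u : Matrix a b S) :
    lY y (u * scalarMat S M) = lY y u * scalarMat S M := by
  ext ⟨i, j⟩ k
  simp [lY, mul_scalarMat_apply, Finset.mul_sum]

theorem rY_mul_scalar [Fintype b] (y : Fin 4 → S) (M : Matrix b c ℂ) (u : Matrix a b S) :
    rY y (u * scalarMat S M) = rY y u * scalarMat S M := by
  ext ⟨i, j⟩ k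
  simp [rY, mul_scalarMat_apply, Finset.sum_mul]

/-- The commutation relation `y u = G u y + H u - (Λ ⊗ u) H`. -/
def YRel {n : Type*} [Fintype n] (y : Fin 4 → S) (Lm : Matrix (Fin 4) (Fin 4) S) (u : Matrix n n S)
    (G : Matrix (Fin 4 × n) (n × Fin 4) ℂ) (H : Matrix (Fin 4 × n) n ℂ) : Prop :=
  lY y u = scalarMat S G * rY y u + scalarMat S H * u - (Lm ⊗ₖ u) * scalarMat S H

theorem YRel.tensor {n m : Type} [Fintype n] [DecidableEq n] [Fintype m] [DecidableEq m]
    {y : Fin 4 → S} {Lm : Matrix (Fin 4) (Fin 4) S} {u : Matrix n n S} {v : Matrix m m S}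
    {G : Matrix (Fin 4 × n) (n × Fin 4) ℂ} {H : Matrix (Fin 4 × n) n ℂ}
    {G' : Matrix (Fin 4 × m) (m × Fin 4) ℂ} {H' : Matrix (Fin 4 × m) m ℂ}
    (h : YRel y Lm u G H) (h' : YRel y Lm v G' H')
    (hG : scalarMat S G * (u ⊗ₖ Lm) = (Lm ⊗ₖ u) * scalarMat S G) :
    (lY y (u ⊗ₖ v)).submatrix (Equiv.prodAssoc (Fin 4) n m) id =
      scalarMat S ((G ⊗ₖ (1 : Matrix m m ℂ)) * rowAssoc (colAssoc ((1 : Matrix n n ℂ) ⊗ₖ G'))) *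
          rY y (u ⊗ₖ v) +
        scalarMat S (H ⊗ₖ (1 : Matrix m m ℂ) +
          (G ⊗ₖ (1 : Matrix m m ℂ)) * rowAssoc ((1 : Matrix n n ℂ) ⊗ₖ H')) * (u ⊗ₖ v) -
        ((Lm ⊗ₖ u) ⊗ₖ v) * scalarMat S (H ⊗ₖ (1 : Matrix m m ℂ) +
          (G ⊗ₖ (1 : Matrix m m ℂ)) * rowAssoc ((1 : Matrix n n ℂ) ⊗ₖ H')) := by
  have a1 : (lY y (u ⊗ₖ v)).submatrix (Equiv.prodAssoc (Fin 4) n m) id = lY y u ⊗ₖ v := by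
    ext ⟨⟨i, j⟩, k⟩ ⟨l, o⟩
    simp [lY, mul_assoc]
  have a2 : rY y u ⊗ₖ v = (u ⊗ₖ lY y v).submatrix (Equiv.prodAssoc n (Fin 4) m) id := by
    ext ⟨⟨i, j⟩, k⟩ ⟨l, o⟩
    simp [lY, rY, mul_assoc]
  have a3 : u ⊗ₖ rY y v = (rY y (u ⊗ₖ v)).submatrix (Equiv.prodAssoc n m (Fin 4)).symm id := by
    ext ⟨i, j, k⟩ ⟨l, o⟩
    simp [rY, mul_assoc]
  have a4 : lY y u ⊗ₖ v = scalarMat S (G ⊗ₖ (1 : Matrix m m ℂ)) * (rY y u ⊗ₖ v) +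
      scalarMat S (H ⊗ₖ (1 : Matrix m m ℂ)) * (u ⊗ₖ v) -
        ((Lm ⊗ₖ u) ⊗ₖ v) * scalarMat S (H ⊗ₖ (1 : Matrix m m ℂ)) := by
    rw [kron_one_mul, kron_one_mul, mul_kron_one, h]
    ext ⟨i, k⟩ ⟨l, o⟩
    simp [sub_mul, add_mul]
  have a5 : u ⊗ₖ lY y v = scalarMat S ((1 : Matrix n n ℂ) ⊗ₖ G') * (u ⊗ₖ rY y v) +
      scalarMat S ((1 : Matrix n n ℂ) ⊗ₖ H') * (u ⊗ₖ v) -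
        (u ⊗ₖ (Lm ⊗ₖ v)) * scalarMat S ((1 : Matrix n n ℂ) ⊗ₖ H') := by
    rw [one_kron_mul, one_kron_mul, mul_one_kron, h']
    ext ⟨i, k⟩ ⟨l, o⟩
    simp [mul_sub, mul_add]
  have a6 : rY y u ⊗ₖ v =
      scalarMat S (rowAssoc (colAssoc ((1 : Matrix n n ℂ) ⊗ₖ G'))) * rY y (u ⊗ₖ v) +
      scalarMat S (rowAssoc ((1 : Matrix n n ℂ) ⊗ₖ H')) * (u ⊗ₖ v) -
        ((u ⊗ₖ Lm) ⊗ₖ v) * scalarMat S (rowAssoc ((1 : Matrix n n ℂ) ⊗ₖ H')) := by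
    have e : rY y (u ⊗ₖ v) =
        ((u ⊗ₖ rY y v)).submatrix (Equiv.prodAssoc n m (Fin 4)) (Equiv.refl _) := by
      rw [a3]; ext; simp
    rw [a2, a5, e, kron_assoc, rowAssoc, rowAssoc, colAssoc, Matrix.submatrix_submatrix,
      scalarMat_submatrix, scalarMat_submatrix, Matrix.submatrix_mul_equiv]
    rw [Function.id_comp, Function.comp_id, Matrix.submatrix_mul_equiv]
    rfl
  rw [a1, a4, a6, Matrix.mul_sub, Matrix.mul_add, scalarMat_add, scalarMat_mul, scalarMat_mul,
    Matrix.add_mul, Matrix.mul_add, ← Matrix.mul_assoc, ← Matrix.mul_assoc, ← Matrix.mul_assoc,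
    kron_one_mul, hG, ← mul_kron_one, Matrix.mul_assoc _ (scalarMat S (G ⊗ₖ _))
      (scalarMat S (rowAssoc ((1 : Matrix n n ℂ) ⊗ₖ H')))]
  abel

end ScalarMat

theorem LambdaMat_apply {S : Type*} [Ring S] [Algebra ℂ S] [Star S]
    (w : Matrix (Fin 2) (Fin 2) S) (i j : Fin 4) :
    LambdaMat w i j = ∑ k : I2, ∑ p : I2, (V k j * Vi i p) • (w p.1 k.1 * star (w p.2 k.2)) := by
  rw [LambdaMat, mul_scalarMat_apply]
  refine Finset.sum_congr rfl fun k _ => ?_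
  rw [scalarMat_mul_apply, Finset.smul_sum]
  simp only [smul_smul, Matrix.kroneckerMap_apply, Matrix.map_apply]

theorem map_LambdaMat {S S' : Type*} [Ring S] [Algebra ℂ S] [StarRing S] [Ring S'] [Algebra ℂ S']
    [StarRing S'] (F : S →⋆ₐ[ℂ] S') (w : Matrix (Fin 2) (Fin 2) S) (i j : Fin 4) :
    F (LambdaMat w i j) = LambdaMat (w.map F) i j := by
  simp only [LambdaMat_apply, map_sum, map_smul, map_mul, map_star, Matrix.map_apply]

theorem star_LambdaMat {S : Type*} [Ring S] [Algebra ℂ S] [StarRing S] [StarModule ℂ S]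
    (w : Matrix (Fin 2) (Fin 2) S) (i j : Fin 4) : star (LambdaMat w i j) = LambdaMat w i j := by
  simp only [LambdaMat_apply, star_sum, star_smul, star_mul, star_star, star_V, star_Vi]
  refine Fintype.sum_equiv (Equiv.prodComm _ _) _ _ fun k => ?_
  refine Fintype.sum_equiv (Equiv.prodComm _ _) _ _ fun p => ?_
  simp [mul_comm]

namespace PoincareData

variable (P : PoincareData)

open UnivStar PGen

/-- The projection onto the algebra of the quantum Poincare group. -/
abbrev mkP : FreeStar PGen →⋆ₐ[ℂ] P.Poincare := UnivStar.mk PGen P.PRel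

theorem mkP_w (A B : Fin 2) : P.mkP (wF A B) = P.w A B := rfl

theorem mkP_y (i : Fin 4) : P.mkP (yF i) = P.y i := rfl

theorem mkP_Lam (i j : Fin 4) : P.mkP (LambdaMat wF i j) = P.Lam i j := map_LambdaMat _ _ _ _

theorem rel_E (A C : Fin 2) :
    ∑ B, ∑ D, P.lorentz.E B D • (P.w A B * P.w C D) = P.lorentz.E A C • 1 := by
  have h := mk_eq (PRel.E_rel (P := P) A C)
  simpa only [map_sum, map_smul, map_mul, map_one, mkP_w] using h

theorem rel_E' (B D : Fin 2) :
    ∑ A, ∑ C, P.lorentz.E' A C • (P.w A B * P.w C D) = P.lorentz.E' B D • 1 := by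
  have h := mk_eq (PRel.E'_rel (P := P) B D)
  simpa only [map_sum, map_smul, map_mul, map_one, mkP_w] using h

theorem rel_X : scalarMat P.Poincare P.lorentz.X * (P.w ⊗ₖ P.wbar) =
    (P.wbar ⊗ₖ P.w) * scalarMat P.Poincare P.lorentz.X := by
  ext ⟨A, B⟩ ⟨K, L⟩
  have h := mk_eq (PRel.X_rel (P := P) A B K L)
  simp only [map_sum, map_smul, map_mul, map_star, mkP_w] at h
  rw [scalarMat_mul_apply, mul_scalarMat_apply, Fintype.sum_prod_type, Fintype.sum_prod_type]
  exact h

theorem rel_Xinv : scalarMat P.Poincare P.lorentz.X⁻¹ * (P.wbar ⊗ₖ P.w) =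
    (P.w ⊗ₖ P.wbar) * scalarMat P.Poincare P.lorentz.X⁻¹ := by
  have h1 : scalarMat P.Poincare P.lorentz.X⁻¹ * scalarMat P.Poincare P.lorentz.X = 1 := by
    rw [← scalarMat_mul, LorentzType.inv_mul_X, scalarMat_one]
  have h2 : scalarMat P.Poincare P.lorentz.X * scalarMat P.Poincare P.lorentz.X⁻¹ = 1 := by
    rw [← scalarMat_mul, LorentzType.X_mul_inv, scalarMat_one]
  calc _ = scalarMat P.Poincare P.lorentz.X⁻¹ * ((P.wbar ⊗ₖ P.w) *
        scalarMat P.Poincare P.lorentz.X) * scalarMat P.Poincare P.lorentz.X⁻¹ := by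
        rw [Matrix.mul_assoc, Matrix.mul_assoc, h2, Matrix.mul_one]
    _ = _ := by rw [← rel_X, ← Matrix.mul_assoc, h1, Matrix.one_mul]

theorem rel_L : scalarMat P.Poincare P.L * (P.w ⊗ₖ P.w) =
    (P.w ⊗ₖ P.w) * scalarMat P.Poincare P.L := by
  have h1 : scalarMat P.Poincare (Matrix.of fun p k : I2 =>
      P.lorentz.E p.1 p.2 * P.lorentz.E' k.1 k.2) * (P.w ⊗ₖ P.w) =
      scalarMat P.Poincare (Matrix.of fun p k : I2 =>
        P.lorentz.E p.1 p.2 * P.lorentz.E' k.1 k.2) := by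
    ext ⟨A, B⟩ ⟨K, L⟩
    rw [scalarMat_mul_apply, Fintype.sum_prod_type]
    simp only [Matrix.of_apply, mul_smul, Matrix.kronecker_apply, scalarMat, Matrix.map_apply,
      ← Finset.smul_sum, rel_E', Algebra.algebraMap_eq_smul_one]
  have h2 : (P.w ⊗ₖ P.w) * scalarMat P.Poincare (Matrix.of fun p k : I2 =>
      P.lorentz.E p.1 p.2 * P.lorentz.E' k.1 k.2) =
      scalarMat P.Poincare (Matrix.of fun p k : I2 =>
        P.lorentz.E p.1 p.2 * P.lorentz.E' k.1 k.2) := by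
    ext ⟨A, B⟩ ⟨K, L⟩
    rw [mul_scalarMat_apply, Fintype.sum_prod_type]
    simp only [Matrix.of_apply, mul_comm (P.lorentz.E _ _), mul_smul, Matrix.kronecker_apply,
      scalarMat, Matrix.map_apply, ← Finset.smul_sum, rel_E, Algebra.algebraMap_eq_smul_one]
  rw [L, scalarMat_smul, scalarMat_add, scalarMat_one, scalarMat_smul, Matrix.smul_mul,
    Matrix.mul_smul, Matrix.add_mul, Matrix.mul_add, Matrix.smul_mul, Matrix.mul_smul, h1, h2,
    Matrix.one_mul, Matrix.mul_one]

theorem rel_Lt : scalarMat P.Poincare P.Lt * (P.wbar ⊗ₖ P.wbar) =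
    (P.wbar ⊗ₖ P.wbar) * scalarMat P.Poincare P.Lt := by
  have key : ∀ p k, P.Lt p k = star (P.L p.swap k.swap) := by
    intro p k
    have hs : star (P.L p.swap k.swap) = P.lorentz.q * P.L p.swap k.swap :=
      congrFun (congrFun P.star_L p.swap) k.swap
    rw [hs]; rfl
  ext p k
  have h := congrArg star (congrFun (congrFun P.rel_L p.swap) k.swap)
  rw [scalarMat_mul_apply, mul_scalarMat_apply] at h ⊢
  simp only [star_sum, star_smul, Matrix.kroneckerMap_apply, star_mul] at h
  have e1 := Equiv.sum_comp (Equiv.prodComm (Fin 2) (Fin 2)) (fun j : I2 =>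
    star (P.L p.swap j) • (star (P.w j.2 k.swap.2) * star (P.w j.1 k.swap.1)))
  have e2 := Equiv.sum_comp (Equiv.prodComm (Fin 2) (Fin 2)) (fun j : I2 =>
    star (P.L j k.swap) • (star (P.w p.swap.2 j.2) * star (P.w p.swap.1 j.1)))
  rw [← e1, ← e2] at h
  simp only [key, Matrix.kroneckerMap_apply]
  exact h

theorem V_Lam : scalarMat P.Poincare V * P.Lam = (P.w ⊗ₖ P.wbar) * scalarMat P.Poincare V := by
  rw [Lam, LambdaMat, ← Matrix.mul_assoc, ← Matrix.mul_assoc, ← scalarMat_mul, V_mul_Vi,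
    scalarMat_one, Matrix.one_mul]
  rfl

theorem Lam_Vi : P.Lam * scalarMat P.Poincare Vi = scalarMat P.Poincare Vi * (P.w ⊗ₖ P.wbar) := by
  rw [Lam, LambdaMat, Matrix.mul_assoc, ← scalarMat_mul, V_mul_Vi, scalarMat_one, Matrix.mul_one]
  rfl

theorem rel_asc {M : Matrix I2 I2 ℂ} {a b c b' c' : Matrix (Fin 2) (Fin 2) P.Poincare}
    (h : scalarMat P.Poincare M * (b ⊗ₖ c) = (b' ⊗ₖ c') * scalarMat P.Poincare M) :
    scalarMat P.Poincare (rowAssoc (colAssoc ((1 : Matrix (Fin 2) (Fin 2) ℂ) ⊗ₖ M))) *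
      ((a ⊗ₖ b) ⊗ₖ c) = ((a ⊗ₖ b') ⊗ₖ c') *
        scalarMat P.Poincare (rowAssoc (colAssoc ((1 : Matrix (Fin 2) (Fin 2) ℂ) ⊗ₖ M))) := by
  have e : rowAssoc (colAssoc ((1 : Matrix (Fin 2) (Fin 2) ℂ) ⊗ₖ M)) =
    ((1 : Matrix (Fin 2) (Fin 2) ℂ) ⊗ₖ M).submatrix (Equiv.prodAssoc _ _ _)
      (Equiv.prodAssoc _ _ _) := rfl
  rw [e, kron_assoc, kron_assoc, scalarMat_submatrix, Matrix.submatrix_mul_equiv,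
    Matrix.submatrix_mul_equiv, one_kron_mul, mul_one_kron, h]

theorem rel_rowV (a : Matrix (Fin 2) (Fin 2) P.Poincare) :
    scalarMat P.Poincare (rowAssoc ((1 : Matrix (Fin 2) (Fin 2) ℂ) ⊗ₖ V)) * (a ⊗ₖ P.Lam) =
      ((a ⊗ₖ P.w) ⊗ₖ P.wbar) *
        scalarMat P.Poincare (rowAssoc ((1 : Matrix (Fin 2) (Fin 2) ℂ) ⊗ₖ V)) := by
  have h := one_kron_mul V a P.Lam
  rw [V_Lam, ← mul_one_kron] at h
  rw [kron_assoc, rowAssoc, scalarMat_submatrix, Matrix.submatrix_mul_equiv, ← h]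
  rfl

theorem rel_Vi_one (a : Matrix (Fin 2) (Fin 2) P.Poincare) :
    scalarMat P.Poincare (Vi ⊗ₖ (1 : Matrix (Fin 2) (Fin 2) ℂ)) * ((P.w ⊗ₖ P.wbar) ⊗ₖ a) =
      (P.Lam ⊗ₖ a) * scalarMat P.Poincare (Vi ⊗ₖ (1 : Matrix (Fin 2) (Fin 2) ℂ)) := by
  rw [kron_one_mul, mul_kron_one, Lam_Vi]

/-- `G` intertwines `w ⊗ Λ` with `Λ ⊗ w`. -/
theorem rel_G : scalarMat P.Poincare P.G * (P.w ⊗ₖ P.Lam) =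
    (P.Lam ⊗ₖ P.w) * scalarMat P.Poincare P.G := by
  rw [G, scalarMat_mul, scalarMat_mul, scalarMat_mul, Matrix.mul_assoc, rel_rowV,
    ← Matrix.mul_assoc, Matrix.mul_assoc _ _ ((P.w ⊗ₖ P.w) ⊗ₖ P.wbar), kron_one_mul, rel_L,
    ← mul_kron_one, ← Matrix.mul_assoc, Matrix.mul_assoc _ _ ((P.w ⊗ₖ P.w) ⊗ₖ P.wbar),
    P.rel_asc P.rel_X, ← Matrix.mul_assoc, rel_Vi_one]
  simp only [Matrix.mul_assoc]

theorem rel_Gi : scalarMat P.Poincare P.Gi * (P.Lam ⊗ₖ P.w) =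
    (P.w ⊗ₖ P.Lam) * scalarMat P.Poincare P.Gi := by
  have h1 : scalarMat P.Poincare P.Gi * scalarMat P.Poincare P.G = 1 := by
    rw [← scalarMat_mul, Gi_mul_G, scalarMat_one]
  have h2 : scalarMat P.Poincare P.G * scalarMat P.Poincare P.Gi = 1 := by
    rw [← scalarMat_mul, G_mul_Gi, scalarMat_one]
  calc _ = scalarMat P.Poincare P.Gi * ((P.Lam ⊗ₖ P.w) *
        scalarMat P.Poincare P.G) * scalarMat P.Poincare P.Gi := by
        rw [Matrix.mul_assoc, Matrix.mul_assoc, h2, Matrix.mul_one]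
    _ = _ := by rw [← rel_G, ← Matrix.mul_assoc, h1, Matrix.one_mul]

/-- `R` intertwines `Λ ⊗ Λ` with itself. -/
theorem rel_R : scalarMat P.Poincare P.R * (P.Lam ⊗ₖ P.Lam) =
    (P.Lam ⊗ₖ P.Lam) * scalarMat P.Poincare P.R := by
  have hmid : ∀ {M : Matrix I2 I2 ℂ} {a b c b' c' d : Matrix (Fin 2) (Fin 2) P.Poincare},
      scalarMat P.Poincare M * (b ⊗ₖ c) = (b' ⊗ₖ c') * scalarMat P.Poincare M →
      scalarMat P.Poincare (mid M) * ((a ⊗ₖ b) ⊗ₖ (c ⊗ₖ d)) =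
        ((a ⊗ₖ b') ⊗ₖ (c' ⊗ₖ d)) * scalarMat P.Poincare (mid M) := by
    intro M a b c b' c' d h
    have e : ∀ b c : Matrix (Fin 2) (Fin 2) P.Poincare, (a ⊗ₖ b) ⊗ₖ (c ⊗ₖ d) =
        (a ⊗ₖ ((b ⊗ₖ c) ⊗ₖ d)).submatrix e3.symm e3.symm := by
      intro b c
      ext ⟨⟨i, j⟩, k, l⟩ ⟨⟨i', j'⟩, k', l'⟩
      simp [e3, mul_assoc]
    rw [e, e, mid_eq', scalarMat_submatrix, Matrix.submatrix_mul_equiv,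
      Matrix.submatrix_mul_equiv, one_kron_mul, kron_one_mul, mul_one_kron, mul_kron_one, h]
  have s1 : scalarMat P.Poincare (V ⊗ₖ V) * (P.Lam ⊗ₖ P.Lam) =
      ((P.w ⊗ₖ P.wbar) ⊗ₖ (P.w ⊗ₖ P.wbar)) * scalarMat P.Poincare (V ⊗ₖ V) := by
    rw [scalarMat_kron_mul, mul_scalarMat_kron, V_Lam]
  have s2 : scalarMat P.Poincare (mid P.lorentz.X⁻¹) *
      ((P.w ⊗ₖ P.wbar) ⊗ₖ (P.w ⊗ₖ P.wbar)) = ((P.w ⊗ₖ P.w) ⊗ₖ (P.wbar ⊗ₖ P.wbar)) *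
        scalarMat P.Poincare (mid P.lorentz.X⁻¹) := hmid P.rel_Xinv
  have s3 : scalarMat P.Poincare (P.L ⊗ₖ P.Lt) *
      ((P.w ⊗ₖ P.w) ⊗ₖ (P.wbar ⊗ₖ P.wbar)) = ((P.w ⊗ₖ P.w) ⊗ₖ (P.wbar ⊗ₖ P.wbar)) *
        scalarMat P.Poincare (P.L ⊗ₖ P.Lt) := by
    rw [scalarMat_kron_mul, mul_scalarMat_kron, rel_L, rel_Lt]
  have s4 : scalarMat P.Poincare (mid P.lorentz.X) *
      ((P.w ⊗ₖ P.w) ⊗ₖ (P.wbar ⊗ₖ P.wbar)) = ((P.w ⊗ₖ P.wbar) ⊗ₖ (P.w ⊗ₖ P.wbar)) *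
        scalarMat P.Poincare (mid P.lorentz.X) := hmid P.rel_X
  have s5 : scalarMat P.Poincare (Vi ⊗ₖ Vi) * ((P.w ⊗ₖ P.wbar) ⊗ₖ (P.w ⊗ₖ P.wbar)) =
      (P.Lam ⊗ₖ P.Lam) * scalarMat P.Poincare (Vi ⊗ₖ Vi) := by
    rw [scalarMat_kron_mul, mul_scalarMat_kron, Lam_Vi]
  rw [R, scalarMat_mul, scalarMat_mul, scalarMat_mul, scalarMat_mul, Matrix.mul_assoc, s1,
    ← Matrix.mul_assoc, Matrix.mul_assoc _ _ ((P.w ⊗ₖ P.wbar) ⊗ₖ (P.w ⊗ₖ P.wbar)), s2,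
    ← Matrix.mul_assoc, Matrix.mul_assoc _ _ ((P.w ⊗ₖ P.w) ⊗ₖ (P.wbar ⊗ₖ P.wbar)), s3,
    ← Matrix.mul_assoc, Matrix.mul_assoc _ _ ((P.w ⊗ₖ P.w) ⊗ₖ (P.wbar ⊗ₖ P.wbar)), s4,
    ← Matrix.mul_assoc, s5]
  simp only [Matrix.mul_assoc]

theorem star_y (i : Fin 4) : star (P.y i) = P.y i := by
  have h := mk_eq (PRel.y_star (P := P) i)
  rwa [map_star] at h

theorem star_Lam (i j : Fin 4) : star (P.Lam i j) = P.Lam i j := star_LambdaMat _ _ _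

theorem rel_yw : YRel P.y P.Lam P.w P.G P.HV := by
  ext ⟨i, A⟩ B
  have h := mk_eq (PRel.yw_rel (P := P) i A B)
  simp only [map_sum, map_sub, map_add, map_smul, map_mul, mkP_w, mkP_y, mkP_Lam] at h
  rw [Matrix.sub_apply, Matrix.add_apply, scalarMat_mul_apply, scalarMat_mul_apply,
    mul_scalarMat_apply, Fintype.sum_prod_type, Fintype.sum_prod_type]
  exact h

/-- The commutation relation of `y` and `w̄`. -/
theorem rel_ywbar : YRel P.y P.Lam P.wbar P.Gt P.HVt := by
  have h0 : scalarMat P.Poincare P.Gi * scalarMat P.Poincare P.G = 1 := by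
    rw [← scalarMat_mul, Gi_mul_G, scalarMat_one]
  have h : rY P.y P.w = scalarMat P.Poincare P.Gi * lY P.y P.w -
      scalarMat P.Poincare (P.Gi * P.HV) * P.w +
        (P.w ⊗ₖ P.Lam) * scalarMat P.Poincare (P.Gi * P.HV) := by
    rw [P.rel_yw, Matrix.mul_sub, Matrix.mul_add, ← Matrix.mul_assoc, h0, Matrix.one_mul,
      scalarMat_mul, ← Matrix.mul_assoc, ← Matrix.mul_assoc (scalarMat P.Poincare P.Gi) (P.Lam ⊗ₖ P.w),
      rel_Gi]
    simp only [Matrix.mul_assoc]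
    abel
  ext ⟨j, C⟩ B
  have h1 := congrArg star (congrFun (congrFun h (C, j)) B)
  have e1 : star (rY P.y P.w (C, j) B) = lY P.y P.wbar (j, C) B := by
    simp [rY, lY, wbar, star_y]
  rw [e1] at h1
  rw [h1, Matrix.add_apply, Matrix.sub_apply, Matrix.sub_apply, Matrix.add_apply,
    scalarMat_mul_apply, scalarMat_mul_apply, mul_scalarMat_apply, scalarMat_mul_apply,
    scalarMat_mul_apply, mul_scalarMat_apply, star_add, star_sub]
  have e2 : star (∑ k, P.Gi (C, j) k • lY P.y P.w k B) =
      ∑ k, P.Gt (j, C) k • rY P.y P.wbar k B := by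
    rw [star_sum, ← Equiv.sum_comp (Equiv.prodComm (Fin 2) (Fin 4))]
    refine Finset.sum_congr rfl fun k _ => ?_
    rw [star_smul, Gt_eq]
    simp [lY, rY, wbar, star_y]
  have e3' : star (∑ k, (P.Gi * P.HV) (C, j) k • P.w k B) =
      - ∑ k, P.HVt (j, C) k • P.wbar k B := by
    rw [star_sum, ← Finset.sum_neg_distrib]
    refine Finset.sum_congr rfl fun k _ => ?_
    rw [star_smul]
    simp [HVt, wbar]
  have e4 : star (∑ k, (P.Gi * P.HV) k B • (P.w ⊗ₖ P.Lam) (C, j) k) =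
      - ∑ k, P.HVt k B • (P.Lam ⊗ₖ P.wbar) (j, C) k := by
    rw [star_sum, ← Finset.sum_neg_distrib, ← Equiv.sum_comp (Equiv.prodComm (Fin 4) (Fin 2))]
    refine Finset.sum_congr rfl fun k _ => ?_
    rw [star_smul]
    simp [HVt, wbar, star_Lam]
  rw [e2, e3', e4]
  abel

/-- The commutation relation of `y` and `Λ`. -/
theorem rel_yLam : YRel P.y P.Lam P.Lam P.R P.Z := by
  have h := P.rel_yw.tensor P.rel_ywbar P.rel_G
  set K := P.HV ⊗ₖ (1 : Matrix (Fin 2) (Fin 2) ℂ) + (P.G ⊗ₖ (1 : Matrix (Fin 2) (Fin 2) ℂ)) *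
    rowAssoc ((1 : Matrix (Fin 2) (Fin 2) ℂ) ⊗ₖ P.HVt) with hK
  set N := (P.G ⊗ₖ (1 : Matrix (Fin 2) (Fin 2) ℂ)) *
    rowAssoc (colAssoc ((1 : Matrix (Fin 2) (Fin 2) ℂ) ⊗ₖ P.Gt)) with hN
  have e0 : P.Lam = scalarMat P.Poincare Vi * (P.w ⊗ₖ P.wbar) * scalarMat P.Poincare V := rfl
  have e1 : lY P.y P.Lam = scalarMat P.Poincare (colAssoc ((1 : Matrix (Fin 4) (Fin 4) ℂ) ⊗ₖ Vi)) *
      (lY P.y (P.w ⊗ₖ P.wbar)).submatrix (Equiv.prodAssoc (Fin 4) (Fin 2) (Fin 2)) id *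
        scalarMat P.Poincare V := by
    rw [e0, lY_mul_scalar, lY_scalar_mul, colAssoc, scalarMat_submatrix,
      Matrix.submatrix_mul_equiv, Matrix.submatrix_id_id]
  have e2 : rY P.y (P.w ⊗ₖ P.wbar) * scalarMat P.Poincare V =
      scalarMat P.Poincare (V ⊗ₖ (1 : Matrix (Fin 4) (Fin 4) ℂ)) * rY P.y P.Lam := by
    rw [← rY_scalar_mul, V_Lam, rY_mul_scalar]
  have e3' : scalarMat P.Poincare (colAssoc ((1 : Matrix (Fin 4) (Fin 4) ℂ) ⊗ₖ Vi)) *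
      ((P.Lam ⊗ₖ P.w) ⊗ₖ P.wbar) = (P.Lam ⊗ₖ P.Lam) *
        scalarMat P.Poincare (colAssoc ((1 : Matrix (Fin 4) (Fin 4) ℂ) ⊗ₖ Vi)) := by
    have := one_kron_mul Vi P.Lam (P.w ⊗ₖ P.wbar)
    rw [← Lam_Vi, ← mul_one_kron] at this
    rw [kron_assoc, colAssoc, scalarMat_submatrix, Matrix.submatrix_mul_equiv, this]
    rfl
  have e4 : P.Z = colAssoc ((1 : Matrix (Fin 4) (Fin 4) ℂ) ⊗ₖ Vi) * K * V := rfl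
  rw [YRel, e1, h, R_eq, ← hN, e4]
  simp only [scalarMat_mul, Matrix.mul_sub, Matrix.mul_add, Matrix.sub_mul, Matrix.add_mul]
  simp only [Matrix.mul_assoc]
  rw [e2, V_Lam, ← Matrix.mul_assoc _ ((P.Lam ⊗ₖ P.w) ⊗ₖ P.wbar), e3']
  simp only [Matrix.mul_assoc]

end PoincareData

/-- Covariance of the quadratic relations of the coordinates, in an algebra which contains the
matrix `Λ`, the translations `y` and the coordinates `x`. -/
theorem covariance {S : Type*} [Ring S] [Algebra ℂ S] {lam : Matrix (Fin 4) (Fin 4) S}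
    {η ξ : Fin 4 → S} {R : Matrix (Fin 4 × Fin 4) (Fin 4 × Fin 4) ℂ}
    {Z : Matrix (Fin 4 × Fin 4) (Fin 4) ℂ} {t : Fin 4 × Fin 4 → ℂ}
    (hlx : ∀ i j k, ξ k * lam i j = lam i j * ξ k) (hyx : ∀ i k, ξ k * η i = η i * ξ k)
    (hRR : R * R = 1)
    (hR : scalarMat S R * (lam ⊗ₖ lam) = (lam ⊗ₖ lam) * scalarMat S R)
    (hy : YRel η lam lam R Z)
    (h1 : (scalarMat S (R - 1)).mulVec ((fun p => η p.1 * η p.2) - (scalarMat S Z).mulVec η +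
      (fun p => algebraMap ℂ S (t p)) - (lam ⊗ₖ lam).mulVec (fun p => algebraMap ℂ S (t p))) = 0)
    (h2 : (scalarMat S (R - 1)).mulVec ((fun p => ξ p.1 * ξ p.2) - (scalarMat S Z).mulVec ξ +
      (fun p => algebraMap ℂ S (t p))) = 0) :
    (scalarMat S (R - 1)).mulVec
      ((fun p => (lam.mulVec ξ + η) p.1 * (lam.mulVec ξ + η) p.2) -
        (scalarMat S Z).mulVec (lam.mulVec ξ + η) + (fun p => algebraMap ℂ S (t p))) = 0 := by
  set τ : Fin 4 × Fin 4 → S := fun p => algebraMap ℂ S (t p)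
  set ρ := scalarMat S (R - 1) with hρ
  have hρ' : ρ = scalarMat S R - 1 := by rw [hρ, scalarMat_sub, scalarMat_one]
  have hcomm : ρ * (lam ⊗ₖ lam) = (lam ⊗ₖ lam) * ρ := by
    rw [hρ', Matrix.sub_mul, Matrix.mul_sub, hR, Matrix.one_mul, Matrix.mul_one]
  have hsq : ρ * scalarMat S R = - ρ := by
    rw [hρ', Matrix.sub_mul, ← scalarMat_mul, hRR, scalarMat_one, Matrix.one_mul, neg_sub]
  have hψ : (fun p : Fin 4 × Fin 4 => (lam.mulVec ξ + η) p.1 * (lam.mulVec ξ + η) p.2) =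
      (lam ⊗ₖ lam).mulVec (fun p => ξ p.1 * ξ p.2) + (rY η lam).mulVec ξ + (lY η lam).mulVec ξ +
        (fun p => η p.1 * η p.2) := by
    funext ⟨k, l⟩
    have a1 : (lam.mulVec ξ) k * (lam.mulVec ξ) l =
        (lam ⊗ₖ lam).mulVec (fun p => ξ p.1 * ξ p.2) (k, l) := by
      simp only [Matrix.mulVec, dotProduct, Fintype.sum_prod_type, Finset.sum_mul_sum,
        Matrix.kroneckerMap_apply]
      refine Finset.sum_congr rfl fun m _ => Finset.sum_congr rfl fun n _ => ?_
      rw [mul_assoc, ← mul_assoc (ξ m), hlx]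
      simp only [mul_assoc]
    have a2 : (lam.mulVec ξ) k * η l = (rY η lam).mulVec ξ (k, l) := by
      simp only [Matrix.mulVec, dotProduct, Finset.sum_mul, rY, Matrix.of_apply, mul_assoc, hyx]
    have a3 : η k * (lam.mulVec ξ) l = (lY η lam).mulVec ξ (k, l) := by
      simp only [Matrix.mulVec, dotProduct, Finset.mul_sum, lY, Matrix.of_apply, mul_assoc]
    simp only [Pi.add_apply, add_mul, mul_add, a1, a2, a3]
    abel
  have hlY : ρ.mulVec ((rY η lam).mulVec ξ + (lY η lam).mulVec ξ) =
      ρ.mulVec ((scalarMat S Z).mulVec (lam.mulVec ξ)) -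
        (lam ⊗ₖ lam).mulVec (ρ.mulVec ((scalarMat S Z).mulVec ξ)) := by
    rw [hy, Matrix.mulVec_add, Matrix.sub_mulVec, Matrix.add_mulVec, Matrix.mulVec_sub,
      Matrix.mulVec_add]
    simp only [Matrix.mulVec_mulVec, ← Matrix.mul_assoc]
    rw [hsq, hcomm, Matrix.neg_mul, Matrix.neg_mulVec]
    abel
  have h2' := congrArg (lam ⊗ₖ lam).mulVec h2
  have hc : ∀ v, ρ.mulVec ((lam ⊗ₖ lam).mulVec v) = (lam ⊗ₖ lam).mulVec (ρ.mulVec v) := by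
    intro v
    rw [Matrix.mulVec_mulVec, Matrix.mulVec_mulVec, hcomm]
  simp only [Matrix.mulVec_add, Matrix.mulVec_sub, Matrix.mulVec_zero] at h1 h2' hlY ⊢
  rw [hψ]
  simp only [Matrix.mulVec_add]
  rw [hc] at h1 ⊢
  have e : ∀ a b c d e1 e2 e3 f1 f2 : Fin 4 × Fin 4 → S,
      a - b + c - d = 0 → e1 - e2 + d = 0 → f1 + f2 = e3 - e2 →
      e1 + f1 + f2 + a - (e3 + b) + c = 0 := by
    intro a b c d e1 e2 e3 f1 f2 x1 x2 x3
    have : e1 + f1 + f2 + a - (e3 + b) + c =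
      (a - b + c - d) + (e1 - e2 + d) + ((f1 + f2) - (e3 - e2)) := by abel
    rw [this, x1, x2, x3]; simp
  exact e _ _ _ _ _ _ _ _ _ h1 h2' hlY

namespace PoincareData

variable (P : PoincareData)

open UnivStar PGen

theorem rel_yy : (scalarMat P.Poincare (P.R - 1)).mulVec ((fun p => P.y p.1 * P.y p.2) -
    (scalarMat P.Poincare P.Z).mulVec P.y + (fun p => algebraMap ℂ P.Poincare (P.TV p.1 p.2)) -
    (P.Lam ⊗ₖ P.Lam).mulVec (fun p => algebraMap ℂ P.Poincare (P.TV p.1 p.2))) = 0 := by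
  funext ⟨i, j⟩
  have h := mk_eq (PRel.y_rel (P := P) i j)
  simp only [map_sum, map_sub, map_add, map_smul, map_mul, map_one, map_zero, mkP_y, mkP_Lam] at h
  simp only [Matrix.mulVec, dotProduct, Fintype.sum_prod_type, scalarMat, Matrix.map_apply,
    Pi.add_apply, Pi.sub_apply, Matrix.kroneckerMap_apply, ← Algebra.smul_def, Pi.zero_apply,
    ← Algebra.commutes]
  simpa only [Algebra.algebraMap_eq_smul_one] using h

/-- The projection onto the algebra of the quantum Minkowski space. -/
abbrev mkM : FreeStar (Fin 4) →⋆ₐ[ℂ] P.Minkowski := UnivStar.mk (Fin 4) P.MRel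

theorem mkM_x (i : Fin 4) : P.mkM (xF i) = P.x i := rfl

theorem rel_xx : (scalarMat P.Minkowski (P.R - 1)).mulVec ((fun p => P.x p.1 * P.x p.2) -
    (scalarMat P.Minkowski P.Z).mulVec P.x +
      (fun p => algebraMap ℂ P.Minkowski (P.TV p.1 p.2))) = 0 := by
  funext ⟨i, j⟩
  have h := mk_eq (MRel.x_rel (P := P) i j)
  simp only [map_sum, map_sub, map_add, map_smul, map_mul, map_one, map_zero, mkM_x] at h
  simp only [Matrix.mulVec, dotProduct, Fintype.sum_prod_type, scalarMat, Matrix.map_apply,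
    Pi.add_apply, Pi.sub_apply, ← Algebra.smul_def, Pi.zero_apply]
  simpa only [Algebra.algebraMap_eq_smul_one] using h

theorem star_x (i : Fin 4) : star (P.x i) = P.x i := by
  have h := mk_eq (MRel.x_star (P := P) i)
  rwa [map_star] at h

/-- The value `Λ^i_j ⊗ x^j + y^i ⊗ 1` of the action on the coordinate `x^i`. -/
def actCoord (i : Fin 4) : P.Poincare ⊗[ℂ] P.Minkowski :=
  ∑ j, P.Lam i j ⊗ₜ[ℂ] P.x j + P.y i ⊗ₜ[ℂ] 1

theorem star_actCoord (i : Fin 4) : star (P.actCoord i) = P.actCoord i := by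
  simp [actCoord, star_Lam, star_x, star_y]

theorem map_scalarMat {S S' : Type*} [Ring S] [Algebra ℂ S] [Ring S'] [Algebra ℂ S']
    (F : S →ₐ[ℂ] S') {m n : Type*} (M : Matrix m n ℂ) (i : m) (j : n) :
    F (scalarMat S M i j) = scalarMat S' M i j := by
  simp [scalarMat]

theorem actCoord_rel (i j : Fin 4) :
    ∑ k, ∑ l, (P.R - 1) (i, j) (k, l) • (P.actCoord k * P.actCoord l -
      ∑ m, P.Z (k, l) m • P.actCoord m + P.TV k l • 1) = 0 := by
  let F : P.Poincare →ₐ[ℂ] P.Poincare ⊗[ℂ] P.Minkowski := Algebra.TensorProduct.includeLeft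
  let F' : P.Minkowski →ₐ[ℂ] P.Poincare ⊗[ℂ] P.Minkowski := Algebra.TensorProduct.includeRight
  have hFF : ∀ a b, F' b * F a = F a * F' b := fun a b => by
    simp [F, F', Algebra.TensorProduct.includeLeft_apply]
  have hmap : ∀ (M : Matrix (Fin 4 × Fin 4) (Fin 4 × Fin 4) ℂ),
      (scalarMat P.Poincare M).map F = scalarMat _ M := fun M => by
    ext p k; exact map_scalarMat F M p k
  have h := covariance (lam := P.Lam.map F) (η := fun i => F (P.y i)) (ξ := fun i => F' (P.x i))
    (R := P.R) (Z := P.Z) (t := fun p => P.TV p.1 p.2)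
    (fun i j k => hFF _ _) (fun i k => hFF _ _) P.R_mul_R ?_ ?_ ?_ ?_
  · have hact : ∀ i, ((P.Lam.map F).mulVec (fun i => F' (P.x i)) + fun i => F (P.y i)) i =
        P.actCoord i := fun i => by
      simp [actCoord, Matrix.mulVec, dotProduct, F, F', Algebra.TensorProduct.includeLeft_apply]
    have h' := congrFun h (i, j)
    simp only [Matrix.mulVec, dotProduct, Fintype.sum_prod_type, scalarMat, Matrix.map_apply,
      Pi.add_apply, Pi.sub_apply, ← Algebra.smul_def, Pi.zero_apply] at h'
    have hact' : ∀ i, ∑ j, F (P.Lam i j) * F' (P.x j) + F (P.y i) = P.actCoord i := hact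
    simp only [hact'] at h'
    simpa only [Algebra.algebraMap_eq_smul_one] using h'
  · ext p k
    have h := congrArg F (congrFun (congrFun P.rel_R p) k)
    simpa only [scalarMat_mul_apply, mul_scalarMat_apply, map_sum, map_smul, map_mul,
      Matrix.kroneckerMap_apply, Matrix.map_apply] using h
  · ext p k
    have h := congrArg F (congrFun (congrFun P.rel_yLam p) k)
    simpa only [scalarMat_mul_apply, mul_scalarMat_apply, map_sum, map_smul, map_mul, map_add,
      map_sub, Matrix.kroneckerMap_apply, Matrix.map_apply, lY, rY, Matrix.of_apply,
      Matrix.add_apply, Matrix.sub_apply] using h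
  · funext p
    have h := congrArg F (congrFun P.rel_yy p)
    simpa only [Matrix.mulVec, dotProduct, map_sum, map_mul, map_add, map_sub, map_zero,
      Matrix.kroneckerMap_apply, Matrix.map_apply, Pi.add_apply, Pi.sub_apply, Pi.zero_apply,
      map_scalarMat, AlgHom.commutes] using h
  · funext p
    have h := congrArg F' (congrFun P.rel_xx p)
    simpa only [Matrix.mulVec, dotProduct, map_sum, map_mul, map_add, map_sub, map_zero,
      Pi.add_apply, Pi.sub_apply, Pi.zero_apply, map_scalarMat, AlgHom.commutes] using h

/-- The action `Ψ` of the quantum Poincare group on the quantum Minkowski space: the unital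
`*`-homomorphism with `Ψ(x^i) = Λ^i_j ⊗ x^j + y^i ⊗ 1`. -/
def Psi : P.Minkowski →⋆ₐ[ℂ] P.Poincare ⊗[ℂ] P.Minkowski :=
  UnivStar.lift P.actCoord fun a b h => by
    have hx : ∀ i, FreeStar.lift P.actCoord (xF i) = P.actCoord i := FreeStar.lift_of _
    cases h with
    | x_rel i j =>
      simpa only [map_sum, map_sub, map_add, map_smul, map_mul, map_one, map_zero, hx]
        using P.actCoord_rel i j
    | x_star i => rw [map_star, hx, star_actCoord]

theorem Psi_x (i : Fin 4) :
    P.Psi (P.x i) = ∑ j, P.Lam i j ⊗ₜ[ℂ] P.x j + P.y i ⊗ₜ[ℂ] 1 :=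
  UnivStar.lift_of _ _ _

/-! Bispinors, gamma matrices and the Dirac operator -/

/-- Indices of bispinors: `ℂ⁴ = ℂ² ⊕ ℂ²`. -/
abbrev Bi : Type := Fin 2 ⊕ Fin 2

/-- The contragredient representation `ᶜw = E⁻¹ w E`; it is the inverse of the transpose of `w`
by `cw_mul_transpose` and `transpose_mul_cw`. -/
def cw : Matrix (Fin 2) (Fin 2) P.Poincare :=
  scalarMat P.Poincare P.lorentz.E⁻¹ * P.w * scalarMat P.Poincare P.lorentz.E

theorem cw_mul_transpose : P.cw * P.w.transpose = 1 := by
  have h : P.w * scalarMat P.Poincare P.lorentz.E * P.w.transpose =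
      scalarMat P.Poincare P.lorentz.E := by
    ext A C
    have h := P.rel_E A C
    rw [Finset.sum_comm] at h
    simp only [Matrix.mul_apply (N := P.w.transpose), mul_scalarMat_apply, Matrix.transpose_apply,
      Finset.sum_mul, smul_mul_assoc, h]
    simp [scalarMat, Algebra.algebraMap_eq_smul_one]
  rw [cw, Matrix.mul_assoc, Matrix.mul_assoc, ← Matrix.mul_assoc P.w, h, ← scalarMat_mul,
    LorentzType.E_inv, LorentzType.E'_mul_E, scalarMat_one]

theorem transpose_mul_cw : P.w.transpose * P.cw = 1 := by
  have h : P.w.transpose * scalarMat P.Poincare P.lorentz.E' * P.w =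
      scalarMat P.Poincare P.lorentz.E' := by
    ext B D
    have h := P.rel_E' B D
    rw [Finset.sum_comm] at h
    simp only [Matrix.mul_apply (N := P.w), mul_scalarMat_apply, Matrix.transpose_apply,
      Finset.sum_mul, smul_mul_assoc, h]
    simp [scalarMat, Algebra.algebraMap_eq_smul_one]
  rw [cw, LorentzType.E_inv, ← Matrix.mul_assoc, ← Matrix.mul_assoc, h, ← scalarMat_mul,
    LorentzType.E'_mul_E, scalarMat_one]

/-- The bispinor representation `𝒢 = ᶜw ⊕ w̄`. -/
def Gcal : Matrix Bi Bi P.Poincare := Matrix.fromBlocks P.cw 0 0 P.wbar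

/-- `D = τ X⁻¹ τ`. -/
def Dmat : Matrix I2 I2 ℂ := P.lorentz.X⁻¹.submatrix Prod.swap Prod.swap

/-- `(σ_i ∘ D)_{KL} = (σ_i)_{AB} D^{AB}_{KL}`. -/
def sigmaD (i : Fin 4) : Matrix (Fin 2) (Fin 2) ℂ :=
  Matrix.of fun K L => ∑ A, ∑ B, pauli i A B * P.Dmat (A, B) (K, L)

/-- `A_i = q^{-1/2} Eᵀ (σ_i ∘ D) E`. -/
def Amat (i : Fin 4) : Matrix (Fin 2) (Fin 2) ℂ :=
  P.lorentz.qh⁻¹ • (P.lorentz.E.transpose * P.sigmaD i * P.lorentz.E)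

/-- The gamma matrices of the quantum Minkowski space. -/
def gamma (i : Fin 4) : Matrix Bi Bi ℂ := Matrix.fromBlocks 0 (P.Amat i) (pauli i) 0

/-- `K = -E (E⁻¹)ᵀ`. -/
def Kmat : Matrix (Fin 2) (Fin 2) ℂ := -(P.lorentz.E * P.lorentz.E⁻¹.transpose)

/-- The matrix `A` which defines the adjoint bispinor. -/
def Aadj : Matrix Bi Bi ℂ := Matrix.fromBlocks 0 P.Kmat.transpose P.Kmat 0

/-- Bispinor functions `φ = ε_a ⊗ φ^a ∈ ℂ⁴ ⊗ 𝒞`, given by their components `φ^a ∈ 𝒞`. -/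
abbrev Bispinor : Type := Bi → P.Minkowski

/-- The elements of `ℬ ⊗ ℂ⁴ ⊗ 𝒞`, given by their four components in `ℬ ⊗ 𝒞`. -/
abbrev ActedBispinor : Type := Bi → P.Poincare ⊗[ℂ] P.Minkowski

/-- The action on bispinor functions: `Ψ~(ε_a ⊗ φ^a) = 𝒢_a^l φ^{a(1)} ⊗ ε_l ⊗ φ^{a(2)}`, so its
component number `l` is the sum over `a` of `(𝒢_a^l ⊗ 1) Ψ(φ^a)`. -/
def PsiTilde (φ : P.Bispinor) : P.ActedBispinor :=
  fun l => ∑ a, (P.Gcal a l ⊗ₜ[ℂ] 1) * P.Psi (φ a)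

/-- The linear operators `∂_i` are the partial derivatives of the quantum Minkowski space:
`∂_i(1) = 0` and `∂_i(x^k f) = δ^k_i f + (R^{kl}_{in} x^n + Z^{kl}_i) ∂_l f`. -/
structure IsPartial (der : Fin 4 → P.Minkowski →ₗ[ℂ] P.Minkowski) : Prop where
  one : ∀ i, der i 1 = 0
  coord_mul : ∀ i k f, der i (P.x k * f) = (if k = i then f else 0) +
    ∑ l, (∑ n, P.R (k, l) (i, n) • P.x n + P.Z (k, l) i • 1) * der l f

/-- The operator `i γ^j ⊗ D_j - m` on four-component objects with components in `M`. -/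
def diracOp {M : Type*} [AddCommGroup M] [Module ℂ M] (D : Fin 4 → M →ₗ[ℂ] M) (m : ℂ)
    (φ : Bi → M) : Bi → M :=
  fun a => Complex.I • (∑ j, ∑ b, P.gamma j a b • D j (φ b)) - m • φ a

end PoincareData

/-- The sesquilinear expression `φ† A χ`, where `φ†` is the row with entries `(φ^a)*`. -/
def sesq {n S : Type*} [Fintype n] [Ring S] [Star S] [Algebra ℂ S] (A : Matrix n n ℂ)
    (φ χ : n → S) : S :=
  dotProduct (Matrix.vecMul (star φ) (scalarMat S A)) χ

end QMink

end

/-! The theorem says that the matrix `A`, and the operators `A γ^j ∂_j`, are invariant under the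
bispinor representation `𝒢`. As `Ψ` is a `*`-homomorphism and `Ψ~` is multiplication of the column
`Ψ(φ)` by `𝒢ᵀ ⊗ 1`, the first identity reduces to `𝒢̄ A 𝒢ᵀ = A` (`Gcal_Aadj`). Up to conjugation this
is `w K (ᶜw)ᵀ = K`, which follows from `w E wᵀ = E` because `K Eᵀ = -E`.

For the Dirac operator two more facts are needed.

* The derivatives are covariant: `(1 ⊗ ∂_j) Ψ(f) = (Λ^i_j ⊗ 1) Ψ(∂_i f)` (`IsPartial.covariant`). The
  coordinates generate the algebra, so this is an induction on `f ↦ x^k f`. The induction step compares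
  coefficients: those of `x^n` agree because `R` commutes with `Λ ⊗ Λ`, and the rest is the
  commutation relation of `y` with `Λ` (`translation_mul_covector`).
* The matrices are covariant: `(𝒢̄ A γ^j 𝒢ᵀ) Λ^i_j = A γ^i` (`Gcal_Aadj_gamma`). The product `A γ^j` is
  block diagonal with blocks `Kᵀ σ_j` and `K A_j = -q^{-1/2} E (σ_j ∘ D) E`. Since
  `Λ^i_j (σ_j)_{LB} = (σ_i)_{DC} w^C_B w̄^D_L`, the factor `w` cancels against `ᶜw` in the first
  block. In the second block the relation between `X⁻¹` and `w ⊗ w̄` turns the factors `w`, `w̄` into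
  `w̄`, `w`, which are then absorbed by `w E wᵀ = E` and its conjugate.

The seven cases enter only through these relations and the fact that `E` is real and invertible. -/

open scoped TensorProduct Kronecker

noncomputable section

namespace QMink

/-! ### Sesquilinear forms and scalar matrices -/

/-- Multiplying both arguments of a form by `u` replaces its matrix `A` by `u* A u`. -/
theorem sesq_mulVec {n S : Type*} [Fintype n] [Ring S] [StarRing S] [Algebra ℂ S]
    (A : Matrix n n ℂ) (u : Matrix n n S) (f h : n → S) :
    sesq A (u.mulVec f) (u.mulVec h) =
      dotProduct (Matrix.vecMul (star f) (u.conjTranspose * scalarMat S A * u)) h := by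
  rw [sesq, Matrix.star_mulVec, Matrix.vecMul_vecMul, Matrix.dotProduct_mulVec,
    Matrix.vecMul_vecMul]

theorem sesq_eq_sum {n S : Type*} [Fintype n] [Ring S] [StarRing S] [Algebra ℂ S]
    (A : Matrix n n ℂ) (f h : n → S) :
    sesq A f h = ∑ b, ∑ a, A a b • (star (f a) * h b) := by
  simp only [sesq, dotProduct, Matrix.vecMul, scalarMat, Matrix.map_apply, Pi.star_apply,
    ← Algebra.commutes, ← Algebra.smul_def, Finset.sum_mul, smul_mul_assoc]

theorem map_sesq {n S S' : Type*} [Fintype n] [Ring S] [StarRing S] [Algebra ℂ S] [Ring S']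
    [StarRing S'] [Algebra ℂ S'] (F : S →⋆ₐ[ℂ] S') (A : Matrix n n ℂ) (f h : n → S) :
    F (sesq A f h) = sesq A (F ∘ f) (F ∘ h) := by
  simp only [sesq_eq_sum, map_sum, map_smul, map_mul, map_star, Function.comp_apply]

section ScalarMat

variable {S : Type*} [Ring S] [Algebra ℂ S]

theorem transpose_scalarMat_mul {a b c : Type*} [Fintype b] (M : Matrix a b ℂ)
    (u : Matrix b c S) :
    (scalarMat S M * u).transpose = u.transpose * scalarMat S M.transpose := by
  ext i j
  rw [Matrix.transpose_apply, scalarMat_mul_apply, mul_scalarMat_apply]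
  rfl

theorem transpose_mul_scalarMat {a b c : Type*} [Fintype b] (M : Matrix b c ℂ)
    (u : Matrix a b S) :
    (u * scalarMat S M).transpose = scalarMat S M.transpose * u.transpose := by
  ext i j
  rw [Matrix.transpose_apply, scalarMat_mul_apply, mul_scalarMat_apply]
  rfl

theorem conjTranspose_scalarMat [StarRing S] [StarModule ℂ S] {a b : Type*} (M : Matrix a b ℂ) :
    (scalarMat S M).conjTranspose = scalarMat S M.conjTranspose := by
  ext i j
  simp only [Matrix.conjTranspose_apply, scalarMat, Matrix.map_apply, algebraMap_star_comm]

theorem scalarMat_fromBlocks {l m n o : Type*} (a : Matrix n l ℂ) (b : Matrix n m ℂ)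
    (c : Matrix o l ℂ) (d : Matrix o m ℂ) : scalarMat S (Matrix.fromBlocks a b c d) =
      Matrix.fromBlocks (scalarMat S a) (scalarMat S b) (scalarMat S c) (scalarMat S d) :=
  Matrix.fromBlocks_map _ _ _ _ _

theorem scalarMat_zero {m n : Type*} :
    scalarMat S (0 : Matrix m n ℂ) = 0 :=
  Matrix.map_zero _ (map_zero _)

/-- The matrix with entry `v^C_b u^D_l` in the row `lb` and the column `DC`, that is
the transpose of `v ⊗ u` up to the order of the two indices in each pair. -/
def flipTranspose {a b c d : Type*} (u : Matrix a b S) (v : Matrix c d S) :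
    Matrix (b × d) (a × c) S :=
  Matrix.of fun p k => v k.2 p.2 * u k.1 p.1

/-- If `x uᵀ = M` and `y vᵀ = N` with scalar matrices `M`, `N`, then the four factors contract from
the inside: first `y` with `v`, whose scalar product can be pulled out, then `x` with `u`. -/
theorem kron_mul_flipTranspose {a b c d e f : Type*} [Fintype b] [Fintype d]
    {x : Matrix e b S} {y : Matrix f d S} {u : Matrix a b S} {v : Matrix c d S}
    {M : Matrix e a ℂ} {N : Matrix f c ℂ} (hx : x * u.transpose = scalarMat S M)
    (hy : y * v.transpose = scalarMat S N) :
    (x ⊗ₖ y) * flipTranspose u v = scalarMat S (M ⊗ₖ N) := by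
  ext ⟨i, j⟩ ⟨k, l⟩
  have hx' : ∑ p, x i p * u k p = algebraMap ℂ S (M i k) := congrFun (congrFun hx i) k
  have hy' : ∑ q, y j q * v l q = algebraMap ℂ S (N j l) := congrFun (congrFun hy j) l
  calc ((x ⊗ₖ y) * flipTranspose u v) (i, j) (k, l)
      = ∑ p, x i p * (∑ q, y j q * v l q) * u k p := by
        simp only [Matrix.mul_apply, Fintype.sum_prod_type, Matrix.kroneckerMap_apply,
          flipTranspose, Matrix.of_apply, Finset.mul_sum, Finset.sum_mul, mul_assoc]
    _ = scalarMat S (M ⊗ₖ N) (i, j) (k, l) := by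
        simp only [hy', ← Algebra.commutes (N j l), mul_assoc, ← Finset.mul_sum, hx', scalarMat,
          Matrix.map_apply, Matrix.kroneckerMap_apply, ← map_mul, mul_comm]

end ScalarMat

namespace PoincareData

variable (P : PoincareData)

/-- The Dirac operator inside the sesquilinear form: the gamma matrices may be moved to the
matrix of the form. -/
theorem sesq_diracOp {S : Type*} [Ring S] [StarRing S] [Algebra ℂ S] (A : Matrix Bi Bi ℂ)
    (D : Fin 4 → S →ₗ[ℂ] S) (m : ℂ) (f h : Bi → S) :
    sesq A f (P.diracOp D m h) =
      Complex.I • ∑ j, sesq (A * P.gamma j) f (D j ∘ h) - m • sesq A f h := by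
  have hd : P.diracOp D m h =
      Complex.I • ∑ j, (scalarMat S (P.gamma j)).mulVec (D j ∘ h) - m • h := by
    funext a
    simp [diracOp, Matrix.mulVec, dotProduct, scalarMat, Algebra.smul_def]
  have hj : ∀ j, sesq (A * P.gamma j) f (D j ∘ h) =
      sesq A f ((scalarMat S (P.gamma j)).mulVec (D j ∘ h)) := fun j => by
    rw [sesq, sesq, Matrix.dotProduct_mulVec, Matrix.vecMul_vecMul, scalarMat_mul]
  simp only [hj]
  simp only [hd, sesq, dotProduct_sub, dotProduct_smul, dotProduct_sum]

/-! ### Invariance of the matrix `A` -/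

theorem conjTranspose_E : P.lorentz.E.conjTranspose = P.lorentz.E.transpose := by
  ext A B
  exact P.lorentz.star_E B A

theorem Kmat_eq : P.Kmat = -(P.lorentz.E * P.lorentz.E'.transpose) := by
  rw [Kmat, LorentzType.E_inv]

theorem Kmat_mul_transpose_E : P.Kmat * P.lorentz.E.transpose = -P.lorentz.E := by
  rw [Kmat_eq, Matrix.neg_mul, Matrix.mul_assoc, ← Matrix.transpose_mul, LorentzType.E_mul_E',
    Matrix.transpose_one, Matrix.mul_one]

theorem conjTranspose_Kmat : P.Kmat.conjTranspose = P.Kmat.transpose := by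
  have h : P.lorentz.E'.transpose.conjTranspose = P.lorentz.E' := by
    ext A B
    exact P.lorentz.star_E' A B
  rw [Kmat_eq, Matrix.conjTranspose_neg, Matrix.conjTranspose_mul, conjTranspose_E, h,
    Matrix.transpose_neg, Matrix.transpose_mul, Matrix.transpose_transpose]

theorem w_E_transpose : P.w * scalarMat P.Poincare P.lorentz.E * P.w.transpose =
    scalarMat P.Poincare P.lorentz.E := by
  ext A C
  have h := P.rel_E A C
  rw [Finset.sum_comm] at h
  simp only [Matrix.mul_apply (N := P.w.transpose), mul_scalarMat_apply, Matrix.transpose_apply,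
    Finset.sum_mul, smul_mul_assoc, h]
  simp [scalarMat, Algebra.algebraMap_eq_smul_one]

theorem wbar_transpose_E : P.wbar * scalarMat P.Poincare P.lorentz.E.transpose *
    P.wbar.transpose = scalarMat P.Poincare P.lorentz.E.transpose := by
  have h := congrArg Matrix.conjTranspose P.w_E_transpose
  rw [Matrix.conjTranspose_mul, Matrix.conjTranspose_mul, conjTranspose_scalarMat,
    conjTranspose_E, ← Matrix.mul_assoc] at h
  exact h

/-- The bilinear form `K` pairs `w` with `ᶜw` invariantly: `(ᶜw)ᵀ = Eᵀ wᵀ (E⁻¹)ᵀ` and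
`K Eᵀ = -E`, which reduces this to `w E wᵀ = E`. -/
theorem w_Kmat_cw : P.w * scalarMat P.Poincare P.Kmat * P.cw.transpose =
    scalarMat P.Poincare P.Kmat := by
  rw [cw, transpose_mul_scalarMat, transpose_scalarMat_mul, ← Matrix.mul_assoc,
    Matrix.mul_assoc P.w, ← scalarMat_mul, Kmat_mul_transpose_E, ← Matrix.mul_assoc,
    ← neg_one_smul ℂ P.lorentz.E, scalarMat_smul, Matrix.mul_smul, Matrix.smul_mul,
    w_E_transpose, Matrix.smul_mul, ← scalarMat_mul, ← scalarMat_smul, Kmat, neg_one_smul]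

theorem cwbar_Kmat_wbar : P.cw.map star * scalarMat P.Poincare P.Kmat.transpose *
    P.wbar.transpose = scalarMat P.Poincare P.Kmat.transpose := by
  have h := congrArg Matrix.conjTranspose P.w_Kmat_cw
  rw [Matrix.conjTranspose_mul, Matrix.conjTranspose_mul, conjTranspose_scalarMat,
    conjTranspose_Kmat, ← Matrix.mul_assoc] at h
  exact h

theorem conj_Gcal : P.Gcal.map star = Matrix.fromBlocks (P.cw.map star) 0 0 P.w := by
  have h : P.wbar.map star = P.w := by
    ext A B
    exact star_star _
  rw [Gcal, Matrix.fromBlocks_map, h]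
  simp [Matrix.map_zero]

/-- Invariance of `A`: `𝒢̄ A 𝒢ᵀ = A`. -/
theorem Gcal_Aadj : P.Gcal.map star * scalarMat P.Poincare P.Aadj * P.Gcal.transpose =
    scalarMat P.Poincare P.Aadj := by
  rw [conj_Gcal, Aadj, Gcal, scalarMat_fromBlocks, scalarMat_zero, Matrix.fromBlocks_transpose,
    Matrix.fromBlocks_multiply, Matrix.fromBlocks_multiply]
  simp only [Matrix.transpose_zero, Matrix.mul_zero, Matrix.zero_mul, add_zero, zero_add,
    w_Kmat_cw, cwbar_Kmat_wbar]

end PoincareData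

/-! ### Covariance of the gamma matrices -/

/-- The entries of `u M_s vᵀ`, contracted with `Λ^r_s`, in terms of the matrix whose columns are the
`M_s` written out as columns. It matters that `Λ` stands on the right of `u` and `v`. -/
theorem sum_mul_scalarMat_mul {S : Type*} [Ring S] [Algebra ℂ S] {a b c d i j : Type*}
    [Fintype b] [Fintype d] [Fintype j] (u : Matrix a b S) (v : Matrix c d S)
    (M : j → Matrix b d ℂ) (Λ : Matrix i j S) (p : a) (k : c) (r : i) :
    ∑ s, (u * scalarMat S (M s) * v.transpose) p k * Λ r s =
      ((u ⊗ₖ v) * (scalarMat S (Matrix.of fun (t : b × d) s => M s t.1 t.2) * Λ.transpose))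
        (p, k) r := by
  simp only [Matrix.mul_apply (M := u ⊗ₖ v), Matrix.mul_apply (N := v.transpose),
    mul_scalarMat_apply, scalarMat_mul_apply, Fintype.sum_prod_type, Finset.sum_mul,
    Finset.mul_sum, Matrix.kroneckerMap_apply, Matrix.transpose_apply, Matrix.of_apply,
    smul_mul_assoc, mul_smul_comm]
  rw [Finset.sum_comm]
  refine (Finset.sum_congr rfl fun _ _ => Finset.sum_comm).trans ?_
  rw [Finset.sum_comm]

namespace PoincareData

variable (P : PoincareData)

/-- The Pauli matrices form a covariant tuple: `Λ^i_j (σ_j)_{LB} = (σ_i)_{DC} w^C_B w̄^D_L`. This is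
`Λ V⁻¹ = V⁻¹ (w ⊗ w̄)`, as `V⁻¹` consists of the transposed Pauli matrices up to the factor
`1/2`. -/
theorem V_mul_transpose_Lam : scalarMat P.Poincare V * P.Lam.transpose =
    flipTranspose P.wbar P.w * scalarMat P.Poincare V := by
  have hV : ∀ (i : Fin 4) (l b : Fin 2), V (l, b) i = 2 * Vi i (b, l) := fun i l b => by
    have := star_pauli i b l
    simp only [V, Vi, Matrix.of_apply, this]
    ring
  ext ⟨l, b⟩ i
  have h := congrFun (congrFun P.Lam_Vi i) (b, l)
  rw [mul_scalarMat_apply, scalarMat_mul_apply] at h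
  rw [scalarMat_mul_apply, mul_scalarMat_apply]
  simp only [hV, mul_smul, ← Finset.smul_sum, Matrix.transpose_apply, h]
  rw [← Equiv.sum_comp (Equiv.prodComm (Fin 2) (Fin 2))]
  simp only [flipTranspose, Finset.smul_sum, Matrix.kroneckerMap_apply, Matrix.of_apply]
  rfl

/-- The matrix with entries `D^{AB}_{KL} = (X⁻¹)^{BA}_{LK}` in the row `KL` and the column `AB`, which
sends the coefficients of `σ_j` to those of `σ_j ∘ D`. -/
def sigmaDCoeff : Matrix I2 I2 ℂ :=
  Matrix.of fun p k => P.lorentz.X⁻¹ k.swap p.swap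

theorem sigmaD_eq (j : Fin 4) (p : I2) :
    P.sigmaD j p.1 p.2 = (P.sigmaDCoeff * V) p j := by
  simp only [sigmaD, Dmat, sigmaDCoeff, V, Matrix.mul_apply, Fintype.sum_prod_type,
    Matrix.of_apply, Matrix.submatrix_apply, mul_comm, Prod.swap]

/-- The relation `X⁻¹ (w̄ ⊗ w) = (w ⊗ w̄) X⁻¹` in terms of flipped transposes. -/
theorem sigmaDCoeff_mul_flipTranspose :
    scalarMat P.Poincare P.sigmaDCoeff * flipTranspose P.wbar P.w =
      flipTranspose P.w P.wbar * scalarMat P.Poincare P.sigmaDCoeff := by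
  ext p k
  have h := congrFun (congrFun P.rel_Xinv k.swap) p.swap
  rw [mul_scalarMat_apply, scalarMat_mul_apply] at h ⊢
  rw [← Equiv.sum_comp (Equiv.prodComm (Fin 2) (Fin 2)),
    ← Equiv.sum_comp (Equiv.prodComm (Fin 2) (Fin 2)) (fun s =>
      P.lorentz.X⁻¹ s p.swap • _)] at h
  exact h.symm

theorem kron_Kmat_V : (Matrix.of fun (p : I2) j => (P.Kmat.transpose * pauli j) p.1 p.2) =
    (P.Kmat.transpose ⊗ₖ (1 : Matrix (Fin 2) (Fin 2) ℂ)) * V := by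
  ext ⟨a, b⟩ j
  simp [Matrix.mul_apply, Fintype.sum_prod_type, Matrix.one_apply, V]

theorem Kmat_mul_Amat (j : Fin 4) : P.Kmat * P.Amat j =
    -(P.lorentz.qh⁻¹ • (P.lorentz.E * P.sigmaD j * P.lorentz.E)) := by
  rw [Amat, Matrix.mul_smul, ← Matrix.mul_assoc, ← Matrix.mul_assoc, Kmat_mul_transpose_E,
    Matrix.neg_mul, Matrix.neg_mul, smul_neg]

theorem kron_E_V : (Matrix.of fun (p : I2) j => (P.Kmat * P.Amat j) p.1 p.2) =
    -P.lorentz.qh⁻¹ • ((P.lorentz.E ⊗ₖ P.lorentz.E.transpose) * (P.sigmaDCoeff * V)) := by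
  ext ⟨a, b⟩ j
  simp only [Kmat_mul_Amat, Matrix.of_apply, Matrix.smul_apply, Matrix.neg_apply, neg_smul]
  congr 2
  simp only [Matrix.mul_apply (M := P.lorentz.E ⊗ₖ P.lorentz.E.transpose), ← sigmaD_eq,
    Fintype.sum_prod_type, Matrix.mul_apply (N := P.lorentz.E), Matrix.mul_apply (M := P.lorentz.E),
    Finset.sum_mul, Matrix.kroneckerMap_apply, Matrix.transpose_apply]
  rw [Finset.sum_comm]
  exact Finset.sum_congr rfl fun _ _ => Finset.sum_congr rfl fun _ _ => mul_right_comm _ _ _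

/-- The block `Kᵀ σ_j` of `A γ^j` is covariant. -/
theorem covariant_pauli (a c : Fin 2) (i : Fin 4) :
    ∑ j, (P.cw.map star * scalarMat P.Poincare (P.Kmat.transpose * pauli j) *
      P.cw.transpose) a c * P.Lam i j =
        algebraMap ℂ P.Poincare ((P.Kmat.transpose * pauli i) a c) := by
  have h1 : P.cw * P.w.transpose = scalarMat P.Poincare 1 := by
    rw [cw_mul_transpose, scalarMat_one]
  rw [sum_mul_scalarMat_mul, kron_Kmat_V, scalarMat_mul, Matrix.mul_assoc, V_mul_transpose_Lam,
    ← Matrix.mul_assoc, mul_scalarMat_kron, scalarMat_one, Matrix.mul_one, ← Matrix.mul_assoc,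
    kron_mul_flipTranspose P.cwbar_Kmat_wbar h1, ← scalarMat_mul, ← kron_Kmat_V]
  rfl

/-- The block `K A_j` of `A γ^j` is covariant. -/
theorem covariant_Amat (a c : Fin 2) (i : Fin 4) :
    ∑ j, (P.w * scalarMat P.Poincare (P.Kmat * P.Amat j) * P.wbar.transpose) a c * P.Lam i j =
      algebraMap ℂ P.Poincare ((P.Kmat * P.Amat i) a c) := by
  rw [sum_mul_scalarMat_mul, kron_E_V, scalarMat_smul, Matrix.smul_mul, Matrix.mul_smul,
    scalarMat_mul, scalarMat_mul, Matrix.mul_assoc, Matrix.mul_assoc, V_mul_transpose_Lam,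
    ← Matrix.mul_assoc (scalarMat P.Poincare P.sigmaDCoeff), sigmaDCoeff_mul_flipTranspose,
    Matrix.mul_assoc, ← Matrix.mul_assoc (P.w ⊗ₖ P.wbar), mul_scalarMat_kron,
    ← Matrix.mul_assoc, kron_mul_flipTranspose P.w_E_transpose P.wbar_transpose_E,
    ← scalarMat_mul, ← scalarMat_mul, ← scalarMat_smul, ← kron_E_V]
  rfl

/-- Covariance of the gamma matrices: `(𝒢̄ A γ^j 𝒢ᵀ) Λ^i_j = A γ^i`. -/
theorem Gcal_Aadj_gamma (a c : Bi) (i : Fin 4) :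
    ∑ j, (P.Gcal.map star * scalarMat P.Poincare (P.Aadj * P.gamma j) * P.Gcal.transpose) a c *
      P.Lam i j = algebraMap ℂ P.Poincare ((P.Aadj * P.gamma i) a c) := by
  have hA : ∀ j, P.Aadj * P.gamma j =
      Matrix.fromBlocks (P.Kmat.transpose * pauli j) 0 0 (P.Kmat * P.Amat j) := fun j => by
    rw [Aadj, gamma, Matrix.fromBlocks_multiply]
    simp only [Matrix.mul_zero, Matrix.zero_mul, add_zero, zero_add]
  have hG : ∀ j, P.Gcal.map star * scalarMat P.Poincare (P.Aadj * P.gamma j) *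
      P.Gcal.transpose = Matrix.fromBlocks
        (P.cw.map star * scalarMat P.Poincare (P.Kmat.transpose * pauli j) * P.cw.transpose) 0 0
        (P.w * scalarMat P.Poincare (P.Kmat * P.Amat j) * P.wbar.transpose) := fun j => by
    rw [conj_Gcal, hA, Gcal, scalarMat_fromBlocks, scalarMat_zero, Matrix.fromBlocks_transpose,
      Matrix.fromBlocks_multiply, Matrix.fromBlocks_multiply]
    simp only [Matrix.transpose_zero, Matrix.mul_zero, Matrix.zero_mul, add_zero, zero_add]
  simp only [hG]
  rw [hA]
  rcases a with a | a <;> rcases c with c | c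
  · exact P.covariant_pauli a c i
  · simp
  · simp
  · exact P.covariant_Amat a c i

end PoincareData

/-! ### Covariance of the partial derivatives -/

/-- `1 ⊗ D` commutes with the multiplication by `a ⊗ 1` from the left. -/
theorem lTensor_tmul_one_mul {A B : Type*} [Ring A] [Algebra ℂ A] [Ring B] [Algebra ℂ B]
    (D : B →ₗ[ℂ] B) (a : A) (t : A ⊗[ℂ] B) :
    D.lTensor A ((a ⊗ₜ[ℂ] 1) * t) = (a ⊗ₜ[ℂ] 1) * D.lTensor A t := by
  induction t with
  | zero => simp
  | tmul b c => simp
  | add t u ht hu => rw [mul_add, map_add, ht, hu, map_add, mul_add]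

/-- The induction step for the covariance of the derivatives, in an algebra which contains `Λ`, the
translations `η` and the coordinates `ξ`. The vector `d` stands for the elements `Ψ(∂_p f)`; the
left side comes from `(1 ⊗ ∂_j) Ψ(x^k f)` and the right side from `Λ^i_j Ψ(∂_i (x^k f))`, both
without the common term `Λ^k_j Ψ(f)`. -/
theorem translation_mul_covector {S : Type*} [Ring S] [Algebra ℂ S]
    {lam : Matrix (Fin 4) (Fin 4) S} {η ξ d : Fin 4 → S}
    {R : Matrix (Fin 4 × Fin 4) (Fin 4 × Fin 4) ℂ}
    {Z : Matrix (Fin 4 × Fin 4) (Fin 4) ℂ}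
    (hlx : ∀ i j k, ξ k * lam i j = lam i j * ξ k)
    (hR : scalarMat S R * (lam ⊗ₖ lam) = (lam ⊗ₖ lam) * scalarMat S R)
    (hy : YRel η lam lam R Z) (k j : Fin 4) :
    ∑ m, lam k m * ∑ l, (∑ n, R (m, l) (j, n) • ξ n + Z (m, l) j • 1) * ∑ p, lam p l * d p +
        η k * ∑ p, lam p j * d p =
      ∑ i, lam i j * ∑ l, (∑ n, R (k, l) (i, n) • (∑ m, lam n m * ξ m + η n) +
        Z (k, l) i • 1) * d l := by
  have hR' : ∀ p n, ∑ i, ∑ m, R (k, p) (i, m) • (lam i j * lam m n) =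
      ∑ m, ∑ l, R (m, l) (j, n) • (lam k m * lam p l) := fun p n => by
    have h := congrFun (congrFun hR (k, p)) (j, n)
    rwa [scalarMat_mul_apply, mul_scalarMat_apply, Fintype.sum_prod_type,
      Fintype.sum_prod_type] at h
  have hy' : ∀ p, η k * lam p j = ∑ i, ∑ n, R (k, p) (i, n) • (lam i j * η n) +
      ∑ i, Z (k, p) i • lam i j - ∑ m, ∑ l, Z (m, l) j • (lam k m * lam p l) := fun p => by
    have h := congrFun (congrFun hy (k, p)) j
    rw [Matrix.sub_apply, Matrix.add_apply, scalarMat_mul_apply, scalarMat_mul_apply,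
      mul_scalarMat_apply, Fintype.sum_prod_type, Fintype.sum_prod_type] at h
    exact h
  -- In both expansions the coefficient of `d p` is `c_n ξ n` summed over `n`, plus a term without
  -- coordinates.
  have hl : ∑ m, lam k m * ∑ l, (∑ n, R (m, l) (j, n) • ξ n + Z (m, l) j • 1) *
        ∑ p, lam p l * d p =
      ∑ p, (∑ n, (∑ m, ∑ l, R (m, l) (j, n) • (lam k m * lam p l)) * ξ n +
        ∑ m, ∑ l, Z (m, l) j • (lam k m * lam p l)) * d p := by
    have h1 : ∀ m l p, lam k m * ((∑ n, R (m, l) (j, n) • ξ n + Z (m, l) j • 1) *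
        (lam p l * d p)) = (∑ n, R (m, l) (j, n) • (lam k m * lam p l) * ξ n +
          Z (m, l) j • (lam k m * lam p l)) * d p := fun m l p => by
      simp only [add_mul, mul_add, Finset.sum_mul, Finset.mul_sum, smul_mul_assoc, mul_smul_comm,
        one_mul, mul_assoc, ← hlx]
    simp only [Finset.mul_sum, h1]
    refine ((Finset.sum_congr rfl fun m _ => Finset.sum_comm).trans Finset.sum_comm).trans ?_
    refine Finset.sum_congr rfl fun p _ => ?_
    simp only [← Finset.sum_mul, Finset.sum_add_distrib]
    congr 2
    simp only [Finset.sum_mul]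
    exact (Finset.sum_congr rfl fun m _ => Finset.sum_comm).trans Finset.sum_comm
  have hr : ∑ i, lam i j * ∑ l, (∑ n, R (k, l) (i, n) • (∑ m, lam n m * ξ m + η n) +
        Z (k, l) i • 1) * d l =
      ∑ p, (∑ n, (∑ i, ∑ m, R (k, p) (i, m) • (lam i j * lam m n)) * ξ n +
        (∑ i, ∑ n, R (k, p) (i, n) • (lam i j * η n) + ∑ i, Z (k, p) i • lam i j)) * d p := by
    have h1 : ∀ i p, lam i j * ((∑ n, R (k, p) (i, n) • (∑ m, lam n m * ξ m + η n) +
        Z (k, p) i • 1) * d p) = (∑ m, ∑ n, R (k, p) (i, n) • (lam i j * lam n m) * ξ m +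
          (∑ n, R (k, p) (i, n) • (lam i j * η n) + Z (k, p) i • lam i j)) * d p := fun i p => by
      rw [Finset.sum_comm, ← mul_assoc, ← add_assoc, ← Finset.sum_add_distrib]
      congr 1
      simp only [mul_add, Finset.mul_sum, smul_add, Finset.smul_sum, mul_smul_comm, mul_one,
        smul_mul_assoc, mul_assoc]
    simp only [Finset.mul_sum, h1]
    rw [Finset.sum_comm]
    refine Finset.sum_congr rfl fun p _ => ?_
    simp only [← Finset.sum_mul, Finset.sum_add_distrib]
    congr 2
    simp only [Finset.sum_mul]
    exact Finset.sum_comm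
  rw [hl, hr, Finset.mul_sum, ← Finset.sum_add_distrib]
  refine Finset.sum_congr rfl fun p _ => ?_
  rw [← mul_assoc, hy', ← add_mul]
  simp only [hR']
  congr 1
  abel

/-- Contracting a covector `lam d` with matrices `N j` which transform by `lam` to `M r`. -/
theorem sum_dotProduct_covector {S n i : Type*} [Ring S] [Fintype n] [Fintype i] (f : n → S)
    (N M : i → Matrix n n S) (lam : Matrix i i S) (d : i → n → S)
    (hN : ∀ a c r, ∑ j, N j a c * lam r j = M r a c) :
    ∑ j, dotProduct (Matrix.vecMul f (N j)) (fun c => ∑ r, lam r j * d r c) =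
      ∑ r, dotProduct (Matrix.vecMul f (M r)) (d r) := by
  have hl : ∀ j, dotProduct (Matrix.vecMul f (N j)) (fun c => ∑ r, lam r j * d r c) =
      ∑ r, ∑ c, ∑ a, f a * (N j a c * lam r j) * d r c := fun j => by
    rw [Finset.sum_comm]
    simp only [dotProduct, Matrix.vecMul, Finset.mul_sum, Finset.sum_mul, mul_assoc]
  have hr : ∀ r, dotProduct (Matrix.vecMul f (M r)) (d r) =
      ∑ j, ∑ c, ∑ a, f a * (N j a c * lam r j) * d r c := fun r => by
    simp only [dotProduct, Matrix.vecMul, ← hN, Finset.mul_sum, Finset.sum_mul]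
    exact (Finset.sum_congr rfl fun _ _ => Finset.sum_comm).trans Finset.sum_comm
  simp only [hl, hr]
  exact Finset.sum_comm

namespace PoincareData

variable (P : PoincareData)

/-- The selfadjoint coordinates generate the algebra of the quantum Minkowski space, so a property
which is preserved by linear combinations and by left multiplication with the coordinates holds
everywhere if it holds for `1`. -/
theorem minkowski_induction {motive : P.Minkowski → Prop} (one : motive 1)
    (add : ∀ f g, motive f → motive g → motive (f + g))
    (smul : ∀ (z : ℂ) f, motive f → motive (z • f))
    (coord_mul : ∀ k f, motive f → motive (P.x k * f)) (f : P.Minkowski) : motive f := by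
  -- The statement for all `g` is needed for products of words.
  have key : ∀ (a : FreeStar (Fin 4)) (g : P.Minkowski), motive g →
      motive (P.mkM a * g) := fun a => by
    induction a using FreeStar.induction with
    | scalar z =>
      intro g hg
      have : P.mkM (algebraMap ℂ _ z) = algebraMap ℂ _ z := AlgHomClass.commutes P.mkM z
      rw [this, ← Algebra.smul_def]
      exact smul z g hg
    | gen p =>
      obtain ⟨i, b⟩ := p
      have hx : P.mkM (FreeStar.gen (i, b)) = P.x i := by
        cases b with
        | false => rfl
        | true => rw [← FreeStar.star_of, map_star]; exact P.star_x i
      intro g hg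
      rw [hx]
      exact coord_mul i g hg
    | mul a b ha hb =>
      intro g hg
      rw [map_mul, mul_assoc]
      exact ha _ (hb g hg)
    | add a b ha hb =>
      intro g hg
      rw [map_add, add_mul]
      exact add _ _ (ha g hg) (hb g hg)
  obtain ⟨a, rfl⟩ := UnivStar.mkAlg_surjective f
  have h := key a 1 one
  rwa [mul_one] at h

variable {P}

/-- The Leibniz rule for `1 ⊗ ∂_j` on the tensor product. -/
theorem IsPartial.lTensor_coord_mul {der : Fin 4 → P.Minkowski →ₗ[ℂ] P.Minkowski}
    (h : P.IsPartial der) (j m : Fin 4) (t : P.Poincare ⊗[ℂ] P.Minkowski) :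
    (der j).lTensor P.Poincare ((1 ⊗ₜ[ℂ] P.x m) * t) = (if m = j then t else 0) +
      ∑ l, (∑ n, P.R (m, l) (j, n) • (1 ⊗ₜ[ℂ] P.x n) + P.Z (m, l) j • 1) *
        (der l).lTensor P.Poincare t := by
  induction t with
  | zero => simp
  | tmul b c =>
    rw [Algebra.TensorProduct.tmul_mul_tmul, one_mul, LinearMap.lTensor_tmul, h.coord_mul,
      TensorProduct.tmul_add, TensorProduct.tmul_sum]
    congr 1
    · split_ifs <;> simp
    · refine Finset.sum_congr rfl fun l _ => ?_
      simp [Algebra.TensorProduct.one_def, add_mul, TensorProduct.tmul_add, Finset.sum_mul,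
        TensorProduct.tmul_sum]
  | add t u ht hu =>
    rw [mul_add, map_add, ht, hu]
    simp only [map_add, mul_add, Finset.sum_add_distrib]
    split_ifs <;> abel

/-- Covariance of the partial derivatives: `(1 ⊗ ∂_j) Ψ(f) = (Λ^i_j ⊗ 1) Ψ(∂_i f)`. -/
theorem IsPartial.covariant {der : Fin 4 → P.Minkowski →ₗ[ℂ] P.Minkowski}
    (h : P.IsPartial der) (f : P.Minkowski) (j : Fin 4) :
    (der j).lTensor P.Poincare (P.Psi f) = ∑ i, (P.Lam i j ⊗ₜ[ℂ] 1) * P.Psi (der i f) := by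
  let F : P.Poincare →ₐ[ℂ] P.Poincare ⊗[ℂ] P.Minkowski := Algebra.TensorProduct.includeLeft
  let F' : P.Minkowski →ₐ[ℂ] P.Poincare ⊗[ℂ] P.Minkowski := Algebra.TensorProduct.includeRight
  induction f using P.minkowski_induction generalizing j with
  | one => simp [h.one, Algebra.TensorProduct.one_def]
  | add f g hf hg => simp only [map_add, mul_add, Finset.sum_add_distrib, hf, hg]
  | smul z f hf => simp only [map_smul, mul_smul_comm, ← Finset.smul_sum, hf]
  | coord_mul k f hf =>
    have hx : ∀ n, P.Psi (P.x n) = ∑ m, F (P.Lam n m) * F' (P.x m) + F (P.y n) := fun n => by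
      rw [Psi_x]
      simp [F, F', Algebra.TensorProduct.includeLeft_apply]
    have hf' : ∀ j, (der j).lTensor P.Poincare (P.Psi f) =
        ∑ i, F (P.Lam i j) * P.Psi (der i f) := hf
    have hF : ∀ (a : P.Poincare) t, (der j).lTensor P.Poincare (F a * t) =
        F a * (der j).lTensor P.Poincare t := lTensor_tmul_one_mul (der j)
    have hF' : ∀ m t, (der j).lTensor P.Poincare (F' (P.x m) * t) = (if m = j then t else 0) +
        ∑ l, (∑ n, P.R (m, l) (j, n) • F' (P.x n) + P.Z (m, l) j • 1) *
          (der l).lTensor P.Poincare t := h.lTensor_coord_mul j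
    have key := translation_mul_covector (lam := P.Lam.map F) (η := fun i => F (P.y i))
      (ξ := fun i => F' (P.x i)) (d := fun i => P.Psi (der i f)) (R := P.R) (Z := P.Z)
      ?_ ?_ ?_ k j
    · have hl : (der j).lTensor P.Poincare (P.Psi (P.x k * f)) = F (P.Lam k j) * P.Psi f +
          (∑ m, F (P.Lam k m) * ∑ l, (∑ n, P.R (m, l) (j, n) • F' (P.x n) + P.Z (m, l) j • 1) *
            ∑ p, F (P.Lam p l) * P.Psi (der p f) +
              F (P.y k) * ∑ p, F (P.Lam p j) * P.Psi (der p f)) := by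
        rw [map_mul, hx, add_mul, Finset.sum_mul, map_add, map_sum]
        simp only [mul_assoc, hF, hF', hf', mul_add, Finset.sum_add_distrib, mul_ite, mul_zero,
          Finset.sum_ite_eq', Finset.mem_univ, if_true, add_assoc]
      have hr : ∑ i, F (P.Lam i j) * P.Psi (der i (P.x k * f)) = F (P.Lam k j) * P.Psi f +
          ∑ i, F (P.Lam i j) * ∑ l, (∑ n, P.R (k, l) (i, n) •
            (∑ m, F (P.Lam n m) * F' (P.x m) + F (P.y n)) + P.Z (k, l) i • 1) *
              P.Psi (der l f) := by
        simp only [h.coord_mul, map_add, map_sum, map_mul, map_smul, map_one, hx, mul_add,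
          Finset.sum_add_distrib, apply_ite P.Psi, map_zero, mul_ite, mul_zero,
          Finset.sum_ite_eq, Finset.mem_univ, if_true]
      rw [hl]
      exact (congrArg (F (P.Lam k j) * P.Psi f + ·) key).trans hr.symm
    · intro i j k
      simp [F, F', Algebra.TensorProduct.includeLeft_apply]
    · ext p k
      have h := congrArg F (congrFun (congrFun P.rel_R p) k)
      simpa only [scalarMat_mul_apply, mul_scalarMat_apply, map_sum, map_smul, map_mul,
        Matrix.kroneckerMap_apply, Matrix.map_apply] using h
    · ext p k
      have h := congrArg F (congrFun (congrFun P.rel_yLam p) k)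
      simpa only [scalarMat_mul_apply, mul_scalarMat_apply, map_sum, map_smul, map_mul, map_add,
        map_sub, Matrix.kroneckerMap_apply, Matrix.map_apply, lY, rY, Matrix.of_apply,
        Matrix.add_apply, Matrix.sub_apply] using h

/-! ### Invariance of the sesquilinear expressions -/

theorem PsiTilde_eq (φ : P.Bispinor) : P.PsiTilde φ =
    (P.Gcal.map fun b => b ⊗ₜ[ℂ] (1 : P.Minkowski)).transpose.mulVec (P.Psi ∘ φ) := rfl

/-- The matrix of a form after both arguments are acted on by `𝒢`, computed in `ℬ`. -/
theorem Gcal_sandwich (M : Matrix Bi Bi ℂ) :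
    (P.Gcal.map fun b => b ⊗ₜ[ℂ] (1 : P.Minkowski)).transpose.conjTranspose *
      scalarMat (P.Poincare ⊗[ℂ] P.Minkowski) M *
        (P.Gcal.map fun b => b ⊗ₜ[ℂ] (1 : P.Minkowski)).transpose =
      (P.Gcal.map star * scalarMat P.Poincare M * P.Gcal.transpose).map
        fun b => b ⊗ₜ[ℂ] (1 : P.Minkowski) := by
  ext a c
  simp only [Matrix.mul_apply (N := Matrix.transpose _), Matrix.map_apply, mul_scalarMat_apply,
    Matrix.transpose_apply, Matrix.conjTranspose_apply, TensorProduct.star_tmul, star_one,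
    TensorProduct.sum_tmul, Finset.sum_mul, smul_mul_assoc, Algebra.TensorProduct.tmul_mul_tmul,
    mul_one, TensorProduct.smul_tmul']

theorem sesq_PsiTilde (φ χ : P.Bispinor) :
    sesq P.Aadj (P.PsiTilde φ) (P.PsiTilde χ) = P.Psi (sesq P.Aadj φ χ) := by
  have h : (scalarMat P.Poincare P.Aadj).map (fun b => b ⊗ₜ[ℂ] (1 : P.Minkowski)) =
      scalarMat (P.Poincare ⊗[ℂ] P.Minkowski) P.Aadj := rfl
  rw [PsiTilde_eq, PsiTilde_eq, sesq_mulVec, Gcal_sandwich, Gcal_Aadj, h, map_sesq]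
  rfl

/-- Invariance of the kinetic term: moving `1 ⊗ ∂_j` past `Ψ` produces the factor `Λ^i_j`, which is
absorbed by the covariance of `A γ^j`. -/
theorem sesq_gamma_PsiTilde {der : Fin 4 → P.Minkowski →ₗ[ℂ] P.Minkowski}
    (h : P.IsPartial der) (φ χ : P.Bispinor) :
    ∑ j, sesq (P.Aadj * P.gamma j) (P.PsiTilde φ)
        ((der j).lTensor P.Poincare ∘ P.PsiTilde χ) =
      P.Psi (∑ i, sesq (P.Aadj * P.gamma i) φ (der i ∘ χ)) := by
  have hD : ∀ j, (der j).lTensor P.Poincare ∘ P.PsiTilde χ =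
      (P.Gcal.map fun b => b ⊗ₜ[ℂ] (1 : P.Minkowski)).transpose.mulVec
        ((der j).lTensor P.Poincare ∘ P.Psi ∘ χ) := fun j => by
    funext l
    simp only [PsiTilde, Function.comp_apply, map_sum, lTensor_tmul_one_mul]
    rfl
  have hj : ∀ j, sesq (P.Aadj * P.gamma j) (P.PsiTilde φ)
      ((der j).lTensor P.Poincare ∘ P.PsiTilde χ) =
      dotProduct (Matrix.vecMul (star (P.Psi ∘ φ)) ((P.Gcal.map star *
        scalarMat P.Poincare (P.Aadj * P.gamma j) * P.Gcal.transpose).map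
          fun b => b ⊗ₜ[ℂ] (1 : P.Minkowski)))
        fun c => ∑ i, (P.Lam i j ⊗ₜ[ℂ] 1) * P.Psi (der i (χ c)) := fun j => by
    rw [hD, PsiTilde_eq, sesq_mulVec, Gcal_sandwich]
    exact congrArg _ (funext fun c => h.covariant (χ c) j)
  rw [map_sum, Finset.sum_congr rfl fun j _ => hj j]
  refine (sum_dotProduct_covector _ _ (fun i => scalarMat _ (P.Aadj * P.gamma i))
    (P.Lam.map fun b => b ⊗ₜ[ℂ] (1 : P.Minkowski)) (fun i c => P.Psi (der i (χ c))) ?_).trans ?_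
  · intro a c i
    have h' := congrArg (fun b => b ⊗ₜ[ℂ] (1 : P.Minkowski)) (P.Gcal_Aadj_gamma a c i)
    simp only [TensorProduct.sum_tmul] at h'
    simp only [Matrix.map_apply, Algebra.TensorProduct.tmul_mul_tmul, mul_one]
    exact h'
  · exact Finset.sum_congr rfl fun i _ => (map_sesq P.Psi _ _ _).symm

end PoincareData

end QMink

end

theorem proposition2p3 (P : QMink.PoincareData) :
    (∀ φ χ : P.Bispinor,
      QMink.sesq P.Aadj (P.PsiTilde φ) (P.PsiTilde χ) = P.Psi (QMink.sesq P.Aadj φ χ)) ∧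
    (∀ der : Fin 4 → P.Minkowski →ₗ[ℂ] P.Minkowski, P.IsPartial der →
      ∀ (m : ℂ) (φ χ : P.Bispinor),
        QMink.sesq P.Aadj (P.PsiTilde φ)
            (P.diracOp (fun j => (der j).lTensor P.Poincare) m (P.PsiTilde χ)) =
          P.Psi (QMink.sesq P.Aadj φ (P.diracOp der m χ))) := by
  refine ⟨P.sesq_PsiTilde, fun der h m φ χ => ?_⟩
  rw [P.sesq_diracOp, P.sesq_diracOp, P.sesq_gamma_PsiTilde h, P.sesq_PsiTilde, map_sub, map_smul,
    map_smul]
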